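/- **Setting.** There are $n=2f+1$ nodes with synchronous clocks, at most $f$ of them malicious (arbitrary behaviour), the others honest. Signatures of honest nodes cannot be forged and the hash function $H$ has no collisions. *Standard synchrony*: every message sent by an honest node to an honest node arrives after a positive delay of at most $\Delta>0$; only finitely many messages arrive in bounded time. All nodes hold the requests to be ordered in advance. Views are numbered $1,2,\dots$; the leader of view $v$ is node $(v \bmod n)+1$, and every node starts in view $1$ at time $0$ holding a genesis certificate of rank $(0,0)$ for the empty chain. **Hamster protocol.** A block of height $h$ is $B_h=(b_h,H(B_{h-1}))$ with $b_h$ a batch of requests. It is split into $f+1$ chunks, which are encoded by an $(n,f+1)$ MDS code into $y_h^1,\dots,y_h^n$; $H(B_h)$ is the Merkle root of these chunks. The identifier block is $I_h=(H(B_h),H(I_{h-1}))$ (with $\perp$ in place of identifiers at $h=1$), and "extends" is the reflexive-transitive closure of "has as predecessor". A certificate $C_v(I)$ is a set of $f+1$ votes of different nodes for $I$ in view $v$; its rank is $(v,\text{height of }I)$, ordered lexicographically. Messages of illegal format are ignored. In view $v$ with leader $L$: - *Propose.* As soon as $L$ has $C_v(I_{h-1})$, it sends to each node $r$ the signed proposal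 $(r,y_h^r,I_h),v,C_v(I_{h-1})$. An honest leader works through all requests: each of them is in one of its successive batches or already in the chain that it starts from. - *Re-propose.* Each node forwards to all nodes the first proposal of each height that it gets, and the proposals tailored for itself. - *Vote.* A node that has $f+1$ different segments of the same $I_h$ decodes; if the result has Merkle root $H(B_h)$, it broadcasts a vote for $I_h$ in view $v$. - *Commit.* When a node first has a proposal containing $C_v(I_h)$, it waits $2\Delta$ and, if it is then still in view $v$, commits $I_h$ directly. A node has committed $I$ if it has directly committed some $J$ that extends $I$; a request is committed if an identifier block of a block containing it is committed. - *Evidence* against $L$: (equivocation) two legal proposals or new-view messages of $L$ for view $v$ neither of which extends the other; (error) $f+1$ different segments of the same $I_h$, signed by $L$, whose decoding has a Merkle root different from that in $I_h$; (silence) $f+1$ nodes blaming $L$. A node in view $v$ blames $L$ if, for some $p\ge 1$, it has voted for fewer than $p$ proposed identifier blocks during its first $(3p+4)\Delta$ in the view. - *View change.* On finding evidence, a node broadcasts it in a quit-view message (or forwards the quit-view message it received) and enters view $v+1$, locks on a highest ranked certificate that it knows, and sends it to the new leader. The leader of a view, $2\Delta$ after entering it, broadcasts a new-view message with a highest ranked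 certificate that it knows. A node that receives a new-view message whose certificate, from an earlier view, ranks at least as high as its lock forwards it and votes for the certified identifier block in the new view. **Theorem (Liveness).** In every execution of the protocol under standard synchrony: 1. All honest nodes continually commit identifier blocks: for every honest node $r$, every time $T$ and every height $h$, node $r$ directly commits at some time $\ge T$ an identifier block of height $\ge h$; and for each height $h\ge1$ it eventually commits an identifier block of height $h$. 2. Every request $q$ is eventually committed by every honest node, unless it is censored in the following sense: the honest nodes remain forever in a view with a malicious leader, and no legal proposal of that leader in that view that reaches an honest node has $q$ in its chain (that is, in the proposed block or in a block that it extends). 3. Let $v$ be a view whose leader is honest. Then no honest node ever has evidence against that leader. For every $p\ge1$, every honest node that enters view $v$ votes for at least $p$ proposed identifier blocks of view $v$ within $(3p+4)\Delta$ after entering it, so no honest node ever blames the leader. If some honest node enters view $v$, then every request is eventually committed by every honest node. -/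

import Mathlib

namespace Hamster

/-! ### Data structures -/

/-- The nodes of a system of `n = 2 f + 1` nodes, numbered from `0`. -/
abbrev Node (f : ℕ) : Type := Fin (2 * f + 1)

/-- The leader of view `v`: node number `(v mod n) + 1` when nodes are counted from `1`. -/
def leader (f v : ℕ) : Node f := ⟨v % (2 * f + 1), Nat.mod_lt _ (Nat.succ_pos _)⟩

/-- A block `B_h = (b_h, H(B_{h-1}))`: a batch of requests and the identifier of the preceding
block (`none` is `⊥`). -/
structure Block (Req D : Type*) where
  reqs : List Req
  prev : Option D

/-- An identifier block `I_h = (H(B_h), H(I_{h-1}))`, with its height `h`. -/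
structure IdBlock (D : Type*) where
  height : ℕ
  root : D
  prev : Option D

/-- The objects that get hashed: leaves and inner nodes of Merkle trees, a fixed padding leaf, and
identifier blocks. -/
inductive HashInput (f : ℕ) (D W : Type*) where
  | leaf (i : Node f) (y : W)
  | node (l r : D)
  | pad
  | ident (I : IdBlock D)

/-- The height of the tip of a chain of identifier blocks; `none` is the empty chain. -/
def tipHeight {D : Type*} : Option (IdBlock D) → ℕ
  | none => 0
  | some I => I.height

/-- Root of the perfect binary tree of depth `d` over the leaves `y s, …, y (s + 2 ^ d - 1)`. -/
def merkle {D : Type*} (node : D → D → D) (y : ℕ → D) : ℕ → ℕ → D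
  | 0, s => y s
  | d + 1, s => node (merkle node y d s) (merkle node y d (s + 2 ^ d))

/-- The fixed ingredients of a system with at most `f` malicious nodes among `2 f + 1`: the
synchronous bound `Δ`; the generator matrix `G` of a linear `(2 f + 1, f + 1)` code over `F`, which
is MDS (any `f + 1` rows form an invertible matrix); the division of a block into `f + 1` chunks,
which are elements of an `F`-vector space `W`; and a collision-free hash function. -/
structure System (f : ℕ) (Req D F W : Type*) [Field F] [AddCommGroup W] [Module F W] where
  Δ : ℝ
  Δ_pos : 0 < Δ
  G : Matrix (Node f) (Fin (f + 1)) F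
  mds : ∀ e : Fin (f + 1) ↪ Node f, (G.submatrix e id).det ≠ 0
  split : Block Req D → Fin (f + 1) → W
  split_injective : Function.Injective split
  hash : HashInput f D W → D
  hash_injective : Function.Injective hash

/-- A segment `Y_h^r = (r, y_h^r, I_h)`. -/
structure Seg (f : ℕ) (D W : Type*) where
  idx : Node f
  chunk : W
  id : IdBlock D

/-- A certificate `C_v(I)`: the votes for `I` in view `v` signed by the nodes in `signers`. -/
structure Cert (f : ℕ) (D : Type*) where
  view : ℕ
  tip : Option (IdBlock D)
  signers : Finset (Node f)

/-- The certificate of the empty chain that every node has at the start; the views of the protocol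
are `1, 2, …`. -/
def genesis (f : ℕ) (D : Type*) : Cert f D := ⟨0, none, ∅⟩

/-- The rank `(v, h)` of a certificate, ordered lexicographically. -/
def Cert.rank {f : ℕ} {D : Type*} (c : Cert f D) : ℕ ×ₗ ℕ := toLex (c.view, tipHeight c.tip)

/-- The signature part of the check of a certificate: it carries `f + 1` different signatures. -/
def Cert.Valid {f : ℕ} {D : Type*} (c : Cert f D) : Prop :=
  c = genesis f D ∨ c.signers.card = f + 1

/-- `⟨proposal, Y_h^r, v, C_v(I_{h-1})⟩`, to be signed by the leader of view `v`. -/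
structure Proposal (f : ℕ) (D W : Type*) where
  seg : Seg f D W
  view : ℕ
  cert : Cert f D

/-- `⟨new-view, v, C⟩`, to be signed by the leader of view `v`. -/
structure NewView (f : ℕ) (D : Type*) where
  view : ℕ
  cert : Cert f D

/-- The messages of a leader that count for equivocation. -/
inductive LeaderMsg (f : ℕ) (D W : Type*) where
  | proposal (p : Proposal f D W)
  | newView (m : NewView f D)

/-- The three types of evidence against the leader of a view. -/
inductive Evidence (f : ℕ) (D W : Type*) where
  | equivocation (a b : LeaderMsg f D W)
  | error (ps : Fin (f + 1) → Proposal f D W)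
  | silence (v : ℕ) (blamers : Finset (Node f))

/-- Signed messages. Proposals and new-view messages are signed by the leader of their view, the
other messages by the node `r`. -/
inductive Msg (f : ℕ) (D W : Type*) where
  | proposal (p : Proposal f D W)
  | newView (m : NewView f D)
  | vote (T : Option (IdBlock D)) (v : ℕ) (r : Node f)
  | blame (v : ℕ) (r : Node f)
  | status (c : Cert f D) (v : ℕ) (r : Node f)
  | quitView (e : Evidence f D W) (v : ℕ) (r : Node f)

section Messages

variable {f : ℕ} {D W : Type*}

/-- The node whose signature a message bears. -/
def Msg.signer : Msg f D W → Node f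
  | .proposal p => leader f p.view
  | .newView m => leader f m.view
  | .vote _ _ r => r
  | .blame _ r => r
  | .status _ _ r => r
  | .quitView _ _ r => r

/-- The signed votes contained in a certificate. -/
def Cert.parts (c : Cert f D) : Set (Msg f D W) :=
  {m | ∃ r ∈ c.signers, m = .vote c.tip c.view r}

/-- The signed messages contained in a message of a leader, itself included. -/
def LeaderMsg.parts : LeaderMsg f D W → Set (Msg f D W)
  | .proposal p => {.proposal p} ∪ p.cert.parts
  | .newView m => {.newView m} ∪ m.cert.parts

/-- The signed messages that a piece of evidence consists of. -/
def Evidence.parts : Evidence f D W → Set (Msg f D W)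
  | .equivocation a b => a.parts ∪ b.parts
  | .error ps => ⋃ a, (LeaderMsg.proposal (ps a)).parts
  | .silence v blamers => {m | ∃ r ∈ blamers, m = .blame v r}

/-- The signed messages contained in a message, itself included. -/
def Msg.parts : Msg f D W → Set (Msg f D W)
  | .proposal p => (LeaderMsg.proposal p).parts
  | .newView m => (LeaderMsg.newView m).parts
  | .vote T v r => {.vote T v r}
  | .blame v r => {.blame v r}
  | .status c v r => {.status c v r} ∪ c.parts
  | .quitView e v r => {.quitView e v r} ∪ e.parts

/-- The view of a message of a leader. -/
def LeaderMsg.view : LeaderMsg f D W → ℕ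
  | .proposal p => p.view
  | .newView m => m.view

/-- The identifier block that a message of a leader puts forward. -/
def LeaderMsg.tip : LeaderMsg f D W → Option (IdBlock D)
  | .proposal p => some p.seg.id
  | .newView m => m.cert.tip

end Messages

section System

variable {f : ℕ} {Req D F W : Type*} [Field F] [AddCommGroup W] [Module F W]
  (S : System f Req D F W)

/-- The encoding `y = G x` of `f + 1` chunks into `2 f + 1` chunks. -/
def System.encode (x : Fin (f + 1) → W) (i : Node f) : W := ∑ j, S.G i j • x j

/-- The Merkle root of the encoding of the chunks `x`; `s`-th leaf is `hash (s | y_s)`. -/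
def System.merkleRoot (x : Fin (f + 1) → W) : D :=
  merkle (fun l r => S.hash (.node l r))
    (fun s => if h : s < 2 * f + 1 then S.hash (.leaf ⟨s, h⟩ (S.encode x ⟨s, h⟩)) else S.hash .pad)
    (Nat.clog 2 (2 * f + 1)) 0

/-- The identifier `H(B)` of a block. -/
def System.blockRoot (B : Block Req D) : D := S.merkleRoot (S.split B)

/-- The identifier `H(I)` of an identifier block. -/
def System.hashId (I : IdBlock D) : D := S.hash (.ident I)

/-- `I` has the right form to follow the (possibly empty) chain with tip `T`. -/
def System.Follows (I : IdBlock D) (T : Option (IdBlock D)) : Prop :=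
  I.prev = T.map S.hashId ∧ I.height = tipHeight T + 1

/-- Extension of identifier blocks: `A` extends `A`, and if `B` is the predecessor of `A` then `A`
extends everything that `B` extends. -/
inductive System.Extends : IdBlock D → IdBlock D → Prop
  | refl (A : IdBlock D) : System.Extends A A
  | step {A B C : IdBlock D} :
      S.Follows A (some B) → System.Extends B C → System.Extends A C

/-- Extension of chains given by their tips; every chain extends the empty one. -/
def System.ExtendsTip : Option (IdBlock D) → Option (IdBlock D) → Prop
  | _, none => True
  | none, some _ => False
  | some A, some B => S.Extends A B

/-- The block identified by `I` contains the request `q`. -/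
def System.Contains (I : IdBlock D) (q : Req) : Prop :=
  ∃ B : Block Req D, S.blockRoot B = I.root ∧ q ∈ B.reqs

/-- Some identifier block of the chain with tip `T` contains the request `q`. -/
def System.ChainContains (T : Option (IdBlock D)) (q : Req) : Prop :=
  ∃ A I, T = some A ∧ S.Extends A I ∧ S.Contains I q

/-- The legal format of a proposal. -/
def System.LegalProposal (p : Proposal f D W) : Prop :=
  p.cert.view = p.view ∧ p.cert.signers.card = f + 1 ∧ S.Follows p.seg.id p.cert.tip

/-- The legal format of a new-view message: its certificate stems from an earlier view. -/
def LegalNewView (m : NewView f D) : Prop :=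
  m.cert.Valid ∧ m.cert.view < m.view

/-- The legal format of a message of a leader. -/
def System.LegalLeaderMsg : LeaderMsg f D W → Prop
  | .proposal p => S.LegalProposal p
  | .newView m => LegalNewView m

/-- `ps` are `f + 1` legal proposals of view `v` with pairwise different segments of the same
identifier block `I`, and their chunks decode to `x`. -/
def System.DecodesTo (v : ℕ) (I : IdBlock D) (ps : Fin (f + 1) → Proposal f D W)
    (x : Fin (f + 1) → W) : Prop :=
  (∀ a, (ps a).view = v ∧ S.LegalProposal (ps a) ∧ (ps a).seg.id = I) ∧
  Function.Injective (fun a => (ps a).seg.idx) ∧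
  ∀ a, (ps a).seg.chunk = S.encode x (ps a).seg.idx

/-- What makes evidence against the leader of view `v` conclusive.
Equivocation: two messages of the leader that do not extend one another.
Error: segments whose decoding differs from the identifier that they contain.
Silence: `f + 1` different nodes blame the leader. -/
def System.Proves (v : ℕ) : Evidence f D W → Prop
  | .equivocation a b =>
      a.view = v ∧ b.view = v ∧ S.LegalLeaderMsg a ∧ S.LegalLeaderMsg b ∧
      ¬ S.ExtendsTip a.tip b.tip ∧ ¬ S.ExtendsTip b.tip a.tip
  | .error ps => ∃ I x, S.DecodesTo v I ps x ∧ S.merkleRoot x ≠ I.root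
  | .silence w blamers => w = v ∧ blamers.card = f + 1

end System

/-! ### Runs -/

/-- The raw data of a run. All behaviour of honest nodes is derived from it below; only the receipts
and the choices that the protocol leaves open are recorded. -/
structure Run (f : ℕ) (Req D W : Type*) where
  /-- The honest nodes; all others are malicious. -/
  honest : Finset (Node f)
  /-- The requests to be ordered, which all nodes have received in advance. -/
  requests : Set Req
  /-- `recv r m t`: the message `m` reaches the node `r` (from anybody) at time `t`. -/
  recv : Node f → Msg f D W → ℝ → Prop
  /-- The evidence that a node broadcasts when it quits a view without having got a quit-view. -/
  quitEvidence : Node f → ℕ → Evidence f D W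
  /-- The certificate on which a node locks when it enters a view. -/
  lock : Node f → ℕ → Cert f D
  /-- The certificate that the leader of a view puts in its new-view message. -/
  newViewCert : ℕ → Cert f D
  /-- The batch of requests in the `k`-th proposal (`k = 0, 1, …`) of the leader of a view. -/
  batch : ℕ → ℕ → List Req
  /-- The signatures in the certificate of the `k`-th proposal of the leader of a view. -/
  proposalSigners : ℕ → ℕ → Finset (Node f)

section Run

variable {f : ℕ} {Req D F W : Type*} [Field F] [AddCommGroup W] [Module F W]
  (S : System f Req D F W) (E : Run f Req D W)

/-- By time `t` node `r` has received the signed message `m`, possibly inside another message. -/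
def Run.Knows (r : Node f) (m : Msg f D W) (t : ℝ) : Prop :=
  ∃ M s, s ≤ t ∧ E.recv r M s ∧ m ∈ M.parts

/-- By time `t` node `r` can present the certificate `c`. -/
def Run.HasCert (r : Node f) (c : Cert f D) (t : ℝ) : Prop :=
  c.Valid ∧ ∀ m ∈ c.parts, E.Knows r m t

/-- `c` is a highest ranked certificate of node `r` at time `t`. -/
def Run.HighestCert (r : Node f) (c : Cert f D) (t : ℝ) : Prop :=
  E.HasCert r c t ∧ ∀ c', E.HasCert r c' t → c'.rank ≤ c.rank

/-- By time `t` node `r` has found evidence against the leader of view `v`. -/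
def Run.HasEvidence (r : Node f) (v : ℕ) (t : ℝ) : Prop :=
  ∃ e : Evidence f D W, S.Proves v e ∧ ∀ m ∈ e.parts, E.Knows r m t

/-- Node `r` enters view `v` at time `t`. All nodes start in view `1` at time `0`, and a node leaves
a view for the next one as soon as it has evidence against the leader. -/
def Run.EntersAt (r : Node f) : ℕ → ℝ → Prop
  | 0, _ => False
  | 1, t => t = 0
  | v + 2, t => ∃ τ, Run.EntersAt r (v + 1) τ ∧
      IsLeast {s | τ ≤ s ∧ E.HasEvidence S r (v + 1) s} t

/-- At time `t` node `r` is in view `v`. -/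
def Run.InView (r : Node f) (v : ℕ) (t : ℝ) : Prop :=
  (∃ τ ≤ t, E.EntersAt S r v τ) ∧ ¬ E.HasEvidence S r v t

/-- At time `t` node `r` quits view `v`, in order to enter view `v + 1`. -/
def Run.QuitsAt (r : Node f) (v : ℕ) (t : ℝ) : Prop :=
  1 ≤ v ∧ E.EntersAt S r (v + 1) t

/-! #### Steady state -/

/-- The identifier blocks which the leader of view `v`, if it is honest, works on in this view: the
block of its new-view message, then the identifier blocks of its successive proposals. -/
def Run.chain (v : ℕ) : ℕ → Option (IdBlock D)
  | 0 => (E.newViewCert v).tip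
  | k + 1 => some
      { height := tipHeight (Run.chain v k) + 1
        root := S.blockRoot ⟨E.batch v k, (Run.chain v k).map IdBlock.root⟩
        prev := (Run.chain v k).map S.hashId }

/-- The block of the `k`-th proposal of the leader of view `v`, if it is honest. -/
def Run.block (v k : ℕ) : Block Req D :=
  ⟨E.batch v k, (E.chain S v k).map IdBlock.root⟩

/-- The certificate in the `k`-th proposal of the leader of view `v`, if it is honest. -/
def Run.proposalCert (v k : ℕ) : Cert f D :=
  ⟨v, E.chain S v k, E.proposalSigners v k⟩

/-- `p` is the `k`-th proposal of the leader of view `v`, if it is honest, tailored for the node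
`p.seg.idx`. -/
def Run.IsProposal (v k : ℕ) (p : Proposal f D W) : Prop :=
  p.view = v ∧ p.cert = E.proposalCert S v k ∧ some p.seg.id = E.chain S v (k + 1) ∧
  p.seg.chunk = S.encode (S.split (E.block S v k)) p.seg.idx

/-- Propose: the moment at which the leader of view `v` first has the certificate that its `k`-th
proposal needs. -/
def Run.ProposesAt (v k : ℕ) (t : ℝ) : Prop :=
  IsLeast {s | E.InView S (leader f v) v s ∧
    ∃ c, c.view = v ∧ c.tip = E.chain S v k ∧ c.signers.card = f + 1 ∧
      E.HasCert (leader f v) c s} t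

/-- Re-propose: node `r` forwards `p` at time `t`, because `p` is the first proposal of its height in
the view, or because `p` is tailored for `r`. -/
def Run.ReproposesAt (r : Node f) (p : Proposal f D W) (t : ℝ) : Prop :=
  S.LegalProposal p ∧ E.Knows r (.proposal p) t ∧
  (IsLeast {s | E.InView S r p.view s ∧ ∃ p', S.LegalProposal p' ∧ p'.view = p.view ∧
      p'.seg.id.height = p.seg.id.height ∧ E.Knows r (.proposal p') s} t ∨
    (p.seg.idx = r ∧ IsLeast {s | E.InView S r p.view s ∧ E.Knows r (.proposal p) s} t))

/-- Vote: node `r` votes at time `t` in view `v` for the proposed identifier block `I`, as soon as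
it decodes the block and finds that it matches `I`. -/
def Run.VotesAt (r : Node f) (v : ℕ) (I : IdBlock D) (t : ℝ) : Prop :=
  IsLeast {s | E.InView S r v s ∧ ∃ ps x, S.DecodesTo v I ps x ∧ S.merkleRoot x = I.root ∧
    ∀ a, E.Knows r (.proposal (ps a)) s} t

/-- The identifier blocks proposed in view `v` for which node `r` has voted by time `t`. -/
def Run.votedBy (r : Node f) (v : ℕ) (t : ℝ) : Set (IdBlock D) :=
  {I | ∃ s ≤ t, E.VotesAt S r v I s}

/-- Pre-commit: in view `v` the commit timer of node `r` for `I` starts at time `t`, when `r` first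
has a proposal for the next height, which contains the certificate of `I`. -/
def Run.PreCommitsAt (r : Node f) (v : ℕ) (I : IdBlock D) (t : ℝ) : Prop :=
  IsLeast {s | E.InView S r v s ∧ ∃ p, S.LegalProposal p ∧ p.view = v ∧ p.cert.tip = some I ∧
    E.Knows r (.proposal p) s} t

/-- Commit: at time `t` the commit timer of `I` has run for `2 Δ` and `r` is still in the view. -/
def Run.DirectlyCommitsAt (r : Node f) (I : IdBlock D) (t : ℝ) : Prop :=
  ∃ v s, E.PreCommitsAt S r v I s ∧ t = s + 2 * S.Δ ∧ E.InView S r v t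

/-- By time `t` node `r` has committed `I`, directly or through a block that extends `I`. -/
def Run.Committed (r : Node f) (I : IdBlock D) (t : ℝ) : Prop :=
  ∃ J, ∃ s ≤ t, E.DirectlyCommitsAt S r J s ∧ S.Extends J I

/-- By time `t` node `r` has committed the request `q`. -/
def Run.CommittedRequest (r : Node f) (q : Req) (t : ℝ) : Prop :=
  ∃ I, E.Committed S r I t ∧ S.Contains I q

/-! #### View change -/

/-- Silence: node `r` blames the leader of view `v` at time `t`, when for some `p ≥ 1` it has spent
`(3 p + 4) Δ` in the view and voted for fewer than `p` proposed identifier blocks. -/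
def Run.BlamesAt (r : Node f) (v : ℕ) (t : ℝ) : Prop :=
  E.InView S r v t ∧ ∃ τ, E.EntersAt S r v τ ∧ ∃ p : ℕ, 1 ≤ p ∧ t = τ + (3 * p + 4) * S.Δ ∧
    (E.votedBy S r v t).encard < p

/-- By time `t` node `r` has received a quit-view for view `v` with conclusive evidence. -/
def Run.GotQuitView (r : Node f) (v : ℕ) (t : ℝ) : Prop :=
  ∃ e k, S.Proves v e ∧ E.Knows r (.quitView e v k) t

/-- New-view: the leader of view `v` sends its new-view message `2 Δ` after it entered the view. -/
def Run.NewViewAt (v : ℕ) (t : ℝ) : Prop :=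
  E.InView S (leader f v) v t ∧ E.EntersAt S (leader f v) v (t - 2 * S.Δ)

/-- View-start: node `r` accepts the new-view message `m` at time `t`. -/
def Run.AcceptsAt (r : Node f) (m : NewView f D) (t : ℝ) : Prop :=
  IsLeast {s | E.InView S r m.view s ∧ LegalNewView m ∧ (E.lock r m.view).rank ≤ m.cert.rank ∧
    E.Knows r (.newView m) s} t

/-! #### Sending -/

/-- An honest node `r` creates and signs the message at time `t`. -/
def Run.Signs (r : Node f) (t : ℝ) : Msg f D W → Prop
  | .proposal p => r = leader f p.view ∧ ∃ k, E.ProposesAt S p.view k t ∧ E.IsProposal S p.view k p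
  | .newView m => r = leader f m.view ∧ E.NewViewAt S m.view t ∧ m.cert = E.newViewCert m.view
  | .vote T v k => r = k ∧ ((∃ I, T = some I ∧ E.VotesAt S r v I t) ∨
      ∃ m : NewView f D, m.view = v ∧ m.cert.tip = T ∧ E.AcceptsAt S r m t)
  | .blame v k => r = k ∧ E.BlamesAt S r v t
  | .status c v k => r = k ∧ E.EntersAt S r v t ∧ c = E.lock r v
  | .quitView e v k => r = k ∧ E.QuitsAt S r v t ∧ ¬ E.GotQuitView S r v t ∧
      e = E.quitEvidence r v

/-- An honest node `r` forwards the message to all nodes at time `t`. -/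
def Run.Forwards (r : Node f) (t : ℝ) : Msg f D W → Prop
  | .proposal p => E.ReproposesAt S r p t
  | .newView m => E.AcceptsAt S r m t
  | .quitView e v k => E.QuitsAt S r v t ∧ S.Proves v e ∧ E.Knows r (.quitView e v k) t
  | _ => False

/-- The node `j` is an addressee of the message when its creator sends it: proposals go to the node
for which they are tailored, status messages to the leader, the others to all nodes. -/
def Addressee (j : Node f) : Msg f D W → Prop
  | .proposal p => p.seg.idx = j
  | .status _ v _ => leader f v = j
  | _ => True

/-- An honest node `r` sends the message `m` to the node `j` at time `t`. -/
def Run.Sends (r : Node f) (m : Msg f D W) (j : Node f) (t : ℝ) : Prop :=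
  (E.Signs S r t m ∧ Addressee j m) ∨ E.Forwards S r t m

/-- Runs of the protocol in the standard synchrony model. Malicious nodes are restricted by nothing
but their number and the unforgeability of the signatures of honest nodes. -/
structure IsExecution : Prop where
  /-- At most `f` nodes are malicious. -/
  few_malicious : E.honestᶜ.card ≤ f
  /-- Bandwidth is bounded: only finitely many messages arrive in bounded time. -/
  locally_finite : ∀ r ∈ E.honest, ∀ T : ℝ,
    {x : Msg f D W × ℝ | x.2 ≤ T ∧ E.recv r x.1 x.2}.Finite
  /-- Standard synchrony: messages between honest nodes arrive within `Δ`. -/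
  synchrony : ∀ r ∈ E.honest, ∀ j ∈ E.honest, ∀ m t, E.Sends S r m j t →
    ∃ s, t < s ∧ s ≤ t + S.Δ ∧ E.recv j m s
  /-- Signatures of honest nodes cannot be forged. -/
  unforgeable : ∀ r ∈ E.honest, ∀ m t, E.Knows r m t → m.signer ∈ E.honest →
    ∃ s < t, E.Signs S m.signer s m
  /-- The evidence in the quit-view of an honest node is evidence that it has found. -/
  quitEvidence_spec : ∀ r ∈ E.honest, ∀ v t, E.QuitsAt S r v t →
    S.Proves v (E.quitEvidence r v) ∧ ∀ m ∈ (E.quitEvidence r v).parts, E.Knows r m t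
  /-- An honest node locks on a highest ranked certificate that it knows. -/
  lock_spec : ∀ r ∈ E.honest, ∀ v t, E.EntersAt S r v t → E.HighestCert r (E.lock r v) t
  /-- An honest leader starts its view from a highest ranked certificate that it knows. -/
  newViewCert_spec : ∀ v, leader f v ∈ E.honest → ∀ t, E.NewViewAt S v t →
    E.HighestCert (leader f v) (E.newViewCert v) t
  /-- An honest leader proposes with a certificate that it knows. -/
  proposalSigners_spec : ∀ v, leader f v ∈ E.honest → ∀ k t, E.ProposesAt S v k t →
    (E.proposalSigners v k).card = f + 1 ∧ E.HasCert (leader f v) (E.proposalCert S v k) t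
  /-- An honest leader puts every request in one of its successive batches, unless the chain that it
  starts from contains the request already. -/
  batch_spec : ∀ v, leader f v ∈ E.honest → ∀ q ∈ E.requests,
    (∃ k, q ∈ E.batch v k) ∨ S.ChainContains (E.newViewCert v).tip q

/-- The request `q` is censored: the honest nodes stay forever in a view of a malicious leader, and
no proposal of this leader that reaches an honest node belongs to a chain containing `q`. -/
def Run.Censored (q : Req) : Prop :=
  ∃ v, leader f v ∉ E.honest ∧
    (∀ r ∈ E.honest, ∃ τ, ∀ t, τ ≤ t → E.InView S r v t) ∧
    ∀ r ∈ E.honest, ∀ p t, E.Knows r (.proposal p) t → p.view = v → S.LegalProposal p →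
      ¬ S.ChainContains (some p.seg.id) q

end Run

end Hamster

/-!
Liveness rests on two facts: nobody ever has evidence against an honest leader, and the view in
which the honest nodes finally stay makes progress whoever leads it.

*Honest leaders.* The proposals and the new-view message of an honest leader lie on one chain, and
by the MDS property the segments of one block decode to what was encoded, so evidence against it can
only consist of `f + 1` blames, one of them honest (`IsExecution.exists_blamesAt_of_hasEvidence`).
Honest nodes enter a view within `Δ` of each other, because a quitting node spreads its evidence
(`IsExecution.exists_entersAt_le`). If the leader enters at `τ` and there is no evidence yet, then
all locks reach it by `τ + 2 Δ`, its new-view message is accepted by `τ + 3 Δ`, it makes its `k`-th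
proposal (`k = 0, 1, …`) by `τ + (3 k + 4) Δ`, and the votes for it are cast `2 Δ` later
(`IsExecution.exists_proposesAt`, `IsExecution.exists_votesAt_of_proposesAt`). Hence an
honest blame needs evidence by that time, while evidence needs a strictly earlier honest blame.
As only finitely many messages arrive in bounded time, first times exist, and there is neither
(`IsExecution.not_hasEvidence`).

*The final view.* Consequently views change only until the first honest leader at the latest, and
some view is entered by all honest nodes and never left (`IsExecution.exists_isFinal`). There, some
honest node never blames, as `f + 1` blames would be evidence; so it votes for unboundedly many
identifier blocks. Without equivocation these have different heights, and re-proposing carries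
proposals of every such height to all honest nodes, which commit their predecessors
(`IsExecution.exists_knows_proposal_height_ge`, `IsExecution.exists_directlyCommitsAt`). By
comparability, everything proposed to an honest node in the final view is eventually committed by
all (`IsExecution.exists_committed_of_knows_proposal`), which gives the claims about requests. Blocks
of all lower heights are committed as well, since certified blocks have complete chains of ancestors
(`IsExecution.exists_ancestor`).
-/

namespace Hamster

/-! ### Codes and chains -/

section Chains

variable {f : ℕ} {Req D F W : Type*} [Field F] [AddCommGroup W] [Module F W]
  {S : System f Req D F W}

/-- By the MDS property, `f + 1` segments determine the encoded chunks. -/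
theorem System.eq_of_encode_eq (e : Fin (f + 1) ↪ Node f) {x y : Fin (f + 1) → W}
    (h : ∀ a, S.encode x (e a) = S.encode y (e a)) : x = y := by
  set M := S.G.submatrix e id with hM
  have hdet : IsUnit M.det := (S.mds e).isUnit
  -- Multiplying the segments by the inverse of the square matrix recovers the chunks.
  have key : ∀ z : Fin (f + 1) → W, ∀ i, ∑ a, M⁻¹ i a • S.encode z (e a) = z i := by
    intro z i
    have h1 : ∀ a, S.encode z (e a) = ∑ j, M a j • z j := fun a => rfl
    simp only [h1, Finset.smul_sum, smul_smul]
    rw [Finset.sum_comm]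
    simp only [← Finset.sum_smul, ← Matrix.mul_apply, Matrix.nonsing_inv_mul _ hdet,
      Matrix.one_apply, ite_smul, one_smul, zero_smul]
    simp
  funext i
  rw [← key x i, ← key y i]
  simp only [h]

theorem System.Follows.pred_unique {I A B : IdBlock D} (hA : S.Follows I (some A))
    (hB : S.Follows I (some B)) : A = B := by
  have h := hA.1.symm.trans hB.1
  simp only [Option.map_some, Option.some.injEq, System.hashId] at h
  simpa using S.hash_injective h

theorem System.Extends.trans {A B C : IdBlock D} (h : S.Extends A B) (h' : S.Extends B C) :
    S.Extends A C := by
  induction h with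
  | refl => exact h'
  | step hf _ ih => exact .step hf (ih h')

theorem System.Extends.eq_or_height_lt {A B : IdBlock D} (h : S.Extends A B) :
    A = B ∨ B.height < A.height := by
  induction h with
  | refl => exact .inl rfl
  | step hf _ ih =>
    have := hf.2
    simp only [tipHeight] at this
    rcases ih with rfl | h <;> right <;> omega

theorem System.Extends.eq_of_height_eq {A B : IdBlock D} (h : S.Extends A B)
    (hh : A.height = B.height) : A = B := by
  rcases h.eq_or_height_lt with h | h
  · exact h
  · omega

/-- A block that extends a lower one does so through its only predecessor. -/
theorem System.Extends.of_follows {A B C : IdBlock D} (h : S.Extends A C)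
    (hh : C.height < A.height) (hf : S.Follows A (some B)) : S.Extends B C := by
  cases h with
  | refl => omega
  | step hf' h => rwa [hf.pred_unique hf']

end Chains

/-! ### Knowledge -/

section Knowledge

variable {f : ℕ} {Req D F W : Type*}

theorem Msg.self_mem_parts (m : Msg f D W) : m ∈ m.parts := by
  cases m <;> simp [Msg.parts, LeaderMsg.parts]

theorem Cert.parts_subset_of_mem {c : Cert f D} {m : Msg f D W} (h : m ∈ c.parts) :
    m.parts ⊆ c.parts := by
  obtain ⟨r, hr, rfl⟩ := h
  rintro _ rfl
  exact ⟨r, hr, rfl⟩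

theorem LeaderMsg.parts_subset_of_mem {a : LeaderMsg f D W} {m : Msg f D W} (h : m ∈ a.parts) :
    m.parts ⊆ a.parts := by
  cases a <;> rcases h with rfl | h
  · exact subset_rfl
  · exact (Cert.parts_subset_of_mem h).trans Set.subset_union_right
  · exact subset_rfl
  · exact (Cert.parts_subset_of_mem h).trans Set.subset_union_right

theorem Evidence.parts_subset_of_mem {e : Evidence f D W} {m : Msg f D W} (h : m ∈ e.parts) :
    m.parts ⊆ e.parts := by
  cases e with
  | equivocation a b =>
    rcases h with h | h
    · exact (LeaderMsg.parts_subset_of_mem h).trans Set.subset_union_left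
    · exact (LeaderMsg.parts_subset_of_mem h).trans Set.subset_union_right
  | error ps =>
    obtain ⟨a, ha⟩ := Set.mem_iUnion.1 h
    exact (LeaderMsg.parts_subset_of_mem ha).trans
      (Set.subset_iUnion (fun a => (LeaderMsg.proposal (ps a)).parts) a)
  | silence v bl =>
    obtain ⟨r, hr, rfl⟩ := h
    rintro _ rfl
    exact ⟨r, hr, rfl⟩

theorem Msg.parts_subset_of_mem {m M : Msg f D W} (h : m ∈ M.parts) : m.parts ⊆ M.parts := by
  cases M with
  | proposal p => exact LeaderMsg.parts_subset_of_mem (a := .proposal p) h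
  | newView p => exact LeaderMsg.parts_subset_of_mem (a := .newView p) h
  | vote T v r => rw [Set.mem_singleton_iff.1 h]
  | blame v r => rw [Set.mem_singleton_iff.1 h]
  | status c v r =>
    rcases h with rfl | h
    · exact subset_rfl
    · exact (Cert.parts_subset_of_mem h).trans Set.subset_union_right
  | quitView e v r =>
    rcases h with rfl | h
    · exact subset_rfl
    · exact (Evidence.parts_subset_of_mem h).trans Set.subset_union_right

theorem Cert.finite_parts (c : Cert f D) : (c.parts : Set (Msg f D W)).Finite := by
  refine (c.signers.finite_toSet.image fun r => Msg.vote c.tip c.view r).subset ?_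
  rintro _ ⟨r, hr, rfl⟩
  exact ⟨r, hr, rfl⟩

theorem LeaderMsg.finite_parts (a : LeaderMsg f D W) : a.parts.Finite := by
  cases a <;> exact (Set.finite_singleton _).union (Cert.finite_parts _)

theorem Evidence.finite_parts (e : Evidence f D W) : e.parts.Finite := by
  cases e with
  | equivocation a b => exact a.finite_parts.union b.finite_parts
  | error ps => exact Set.finite_iUnion fun a => LeaderMsg.finite_parts _
  | silence v bl =>
    refine (bl.finite_toSet.image fun r => Msg.blame v r).subset ?_
    rintro _ ⟨r, hr, rfl⟩
    exact ⟨r, hr, rfl⟩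

theorem Msg.finite_parts (m : Msg f D W) : m.parts.Finite := by
  cases m with
  | proposal p => exact LeaderMsg.finite_parts (.proposal p)
  | newView p => exact LeaderMsg.finite_parts (.newView p)
  | vote T v r => exact Set.finite_singleton _
  | blame v r => exact Set.finite_singleton _
  | status c v r => exact (Set.finite_singleton _).union (Cert.finite_parts _)
  | quitView e v r => exact (Set.finite_singleton _).union (Evidence.finite_parts _)

variable {E : Run f Req D W} {r : Node f}

theorem Run.Knows.mono {m : Msg f D W} {s t : ℝ} (h : E.Knows r m s) (hst : s ≤ t) :
    E.Knows r m t := by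
  obtain ⟨M, u, hu, hM⟩ := h
  exact ⟨M, u, hu.trans hst, hM⟩

theorem Run.Knows.of_mem_parts {m m' : Msg f D W} {t : ℝ} (h : E.Knows r m t)
    (h' : m' ∈ m.parts) : E.Knows r m' t := by
  obtain ⟨M, u, hu, hM, hm⟩ := h
  exact ⟨M, u, hu, hM, Msg.parts_subset_of_mem hm h'⟩

theorem Run.Knows.of_recv {m : Msg f D W} {t : ℝ} (h : E.recv r m t) : E.Knows r m t :=
  ⟨m, t, le_rfl, h, m.self_mem_parts⟩

theorem Run.knows_cert_of_proposal {p : Proposal f D W} {t : ℝ}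
    (h : E.Knows r (.proposal p) t) : ∀ m ∈ p.cert.parts, E.Knows r m t :=
  fun _ hm => h.of_mem_parts (.inr hm)

theorem Run.knows_cert_of_newView {m : NewView f D} {t : ℝ}
    (h : E.Knows r (.newView m) t) : ∀ m' ∈ m.cert.parts, E.Knows r m' t :=
  fun _ hm => h.of_mem_parts (.inr hm)

variable [Field F] [AddCommGroup W] [Module F W] {S : System f Req D F W}

theorem Run.HasEvidence.mono {v : ℕ} {s t : ℝ} (h : E.HasEvidence S r v s) (hst : s ≤ t) :
    E.HasEvidence S r v t := by
  obtain ⟨e, he, hk⟩ := h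
  exact ⟨e, he, fun m hm => (hk m hm).mono hst⟩

theorem Run.hasEvidence_congr {v : ℕ} {s t : ℝ} (h : ∀ m, E.Knows r m s ↔ E.Knows r m t) :
    E.HasEvidence S r v s ↔ E.HasEvidence S r v t := by
  simp only [Run.HasEvidence, h]

theorem IsExecution.finite_known (hE : IsExecution S E) (hr : r ∈ E.honest) (T : ℝ) :
    {m | E.Knows r m T}.Finite := by
  refine ((hE.locally_finite r hr T).biUnion fun x _ => x.1.finite_parts).subset ?_
  rintro m ⟨M, s, hs, hM, hm⟩
  exact Set.mem_biUnion (x := (M, s)) ⟨hs, hM⟩ hm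

/-- Knowledge changes only at the finitely many receipt times, so a condition on what a node knows
that holds at some time from `τ` on holds at a first such time. -/
theorem IsExecution.exists_isLeast (hE : IsExecution S E) (hr : r ∈ E.honest) {P : ℝ → Prop}
    (hP : ∀ s s', (∀ m, E.Knows r m s ↔ E.Knows r m s') → P s → P s') {τ t : ℝ} (hτ : τ ≤ t)
    (ht : P t) : ∃ u ≤ t, IsLeast {s | τ ≤ s ∧ P s} u := by
  set R : Set ℝ := insert τ (Prod.snd '' {x : Msg f D W × ℝ | x.2 ≤ t ∧ E.recv r x.1 x.2}) with hR
  have hfin : R.Finite := ((hE.locally_finite r hr t).image _).insert _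
  -- Every time `s` has the same knowledge as the last time of `R` up to `s`.
  have key : ∀ s, τ ≤ s → s ≤ t → P s → ∃ u ∈ R, τ ≤ u ∧ u ≤ s ∧ P u := by
    intro s hτs hst hs
    obtain ⟨u, ⟨huR, hus⟩, hmax⟩ := Set.exists_max_image {u ∈ R | u ≤ s} id
      (hfin.subset (Set.sep_subset _ _)) ⟨τ, Set.mem_insert _ _, hτs⟩
    refine ⟨u, huR, hmax τ ⟨Set.mem_insert _ _, hτs⟩, hus, hP s u (fun m => ⟨?_, ?_⟩) hs⟩
    · rintro ⟨M, x, hx, hM, hm⟩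
      exact ⟨M, x, hmax x ⟨Set.mem_insert_of_mem _ ⟨(M, x), ⟨hx.trans hst, hM⟩, rfl⟩, hx⟩, hM, hm⟩
    · exact fun h => h.mono hus
  obtain ⟨u₀, hu₀R, hτu₀, hu₀t, hPu₀⟩ := key t hτ le_rfl ht
  obtain ⟨u, ⟨huR, hτu, hPu⟩, hmin⟩ := Set.exists_min_image {u ∈ R | τ ≤ u ∧ P u} id
    (hfin.subset (Set.sep_subset _ _)) ⟨u₀, hu₀R, hτu₀, hPu₀⟩
  have hut : u ≤ t := (hmin u₀ ⟨hu₀R, hτu₀, hPu₀⟩).trans hu₀t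
  refine ⟨u, hut, ⟨hτu, hPu⟩, ?_⟩
  rintro s ⟨hτs, hPs⟩
  rcases le_total s t with hst | hst
  · obtain ⟨w, hwR, hτw, hws, hPw⟩ := key s hτs hst hPs
    exact (hmin w ⟨hwR, hτw, hPw⟩).trans hws
  · exact hut.trans hst

end Knowledge

/-! ### Quorums -/

section Quorums

variable {f : ℕ} {Req D F W : Type*} [Field F] [AddCommGroup W] [Module F W]
  {S : System f Req D F W} {E : Run f Req D W}

theorem IsExecution.exists_honest_mem (hE : IsExecution S E) {s : Finset (Node f)}
    (hs : s.card = f + 1) : ∃ r ∈ s, r ∈ E.honest := by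
  by_contra! h
  have hsub : s ⊆ E.honestᶜ := fun r hr => Finset.mem_compl.2 (h r hr)
  have := Finset.card_le_card hsub
  have := hE.few_malicious
  omega

theorem IsExecution.exists_quorum (hE : IsExecution S E) :
    ∃ s : Finset (Node f), s ⊆ E.honest ∧ s.card = f + 1 := by
  have h1 := hE.few_malicious
  have h2 := Finset.card_add_card_compl E.honest
  rw [Fintype.card_fin] at h2
  exact Finset.exists_subset_card_eq (by omega)

theorem IsExecution.exists_quorum_embedding (hE : IsExecution S E) :
    ∃ e : Fin (f + 1) ↪ Node f, ∀ a, e a ∈ E.honest := by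
  obtain ⟨s, hs, hc⟩ := hE.exists_quorum
  exact ⟨(s.orderEmbOfFin hc).toEmbedding, fun a => hs (s.orderEmbOfFin_mem hc a)⟩

/-- A certificate of `f + 1` votes contains the vote of an honest node. -/
theorem IsExecution.exists_honest_vote (hE : IsExecution S E) {r : Node f} (hr : r ∈ E.honest)
    {c : Cert f D} (hc : c.signers.card = f + 1) {t : ℝ}
    (hk : ∀ m ∈ c.parts, E.Knows r m t) :
    ∃ j ∈ E.honest, E.Knows r (.vote c.tip c.view j) t ∧
      ∃ s < t, E.Signs S j s (.vote c.tip c.view j) := by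
  obtain ⟨j, hj, hjh⟩ := hE.exists_honest_mem hc
  have h := hk _ ⟨j, hj, rfl⟩
  exact ⟨j, hjh, h, hE.unforgeable r hr _ t h hjh⟩

end Quorums

/-! ### Views -/

section Views

variable {f : ℕ} {Req D F W : Type*} [Field F] [AddCommGroup W] [Module F W]
  {S : System f Req D F W} {E : Run f Req D W} {r j : Node f} {v : ℕ}

theorem Run.EntersAt.one_le {t : ℝ} (h : E.EntersAt S r v t) : 1 ≤ v := by
  rcases v with _ | v
  · exact h.elim
  · omega

theorem Run.entersAt_succ (hv : 1 ≤ v) {t : ℝ} : E.EntersAt S r (v + 1) t ↔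
    ∃ τ, E.EntersAt S r v τ ∧ IsLeast {s | τ ≤ s ∧ E.HasEvidence S r v s} t := by
  obtain ⟨v, rfl⟩ := Nat.exists_eq_add_of_le' hv
  rfl

theorem Run.EntersAt.unique {s t : ℝ} (hs : E.EntersAt S r v s) (ht : E.EntersAt S r v t) :
    s = t := by
  have h1 := hs.one_le
  induction v, h1 using Nat.le_induction generalizing s t with
  | base => exact Eq.trans hs (Eq.symm ht)
  | succ v hv ih =>
    obtain ⟨a, ha, has⟩ := (Run.entersAt_succ hv).1 hs
    obtain ⟨b, hb, hbt⟩ := (Run.entersAt_succ hv).1 ht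
    rw [ih ha hb] at has
    exact has.unique hbt

theorem Run.EntersAt.inView {s t : ℝ} (h : E.EntersAt S r v s) (hst : s ≤ t)
    (he : ¬ E.HasEvidence S r v t) : E.InView S r v t :=
  ⟨⟨s, hst, h⟩, he⟩

/-- Views are entered one after the other, on evidence against the preceding leaders. -/
theorem Run.EntersAt.exists_of_lt {w : ℕ} {t : ℝ} (h : E.EntersAt S r w t) (hv : 1 ≤ v)
    (hvw : v < w) : (∃ τ ≤ t, E.EntersAt S r v τ) ∧ E.HasEvidence S r v t := by
  induction w, hvw using Nat.le_induction generalizing t with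
  | base =>
    obtain ⟨τ, hτ, hl⟩ := (Run.entersAt_succ hv).1 h
    exact ⟨⟨τ, hl.1.1, hτ⟩, hl.1.2⟩
  | succ w hw ih =>
    obtain ⟨τ, hτ, hl⟩ := (Run.entersAt_succ (by omega)).1 h
    obtain ⟨⟨τ', h1, h2⟩, h3⟩ := ih hτ
    exact ⟨⟨τ', h1.trans hl.1.1, h2⟩, h3.mono hl.1.1⟩

theorem IsExecution.enters_succ (hE : IsExecution S E) (hr : r ∈ E.honest) {τ t : ℝ}
    (h : E.EntersAt S r v τ) (hτ : τ ≤ t) (he : E.HasEvidence S r v t) :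
    ∃ u ≤ t, E.EntersAt S r (v + 1) u := by
  obtain ⟨u, hut, hu⟩ := hE.exists_isLeast hr
    (P := fun s => E.HasEvidence S r v s) (fun s s' h => (Run.hasEvidence_congr h).1) hτ he
  exact ⟨u, hut, (Run.entersAt_succ h.one_le).2 ⟨τ, h, hu⟩⟩

/-- A condition on what a node knows that holds at some time in a view holds at a first such
time. -/
theorem IsExecution.exists_isLeast_inView (hE : IsExecution S E) (hr : r ∈ E.honest)
    {P : ℝ → Prop} (hP : ∀ s s', (∀ m, E.Knows r m s ↔ E.Knows r m s') → P s → P s') {t : ℝ}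
    (hv : E.InView S r v t) (ht : P t) : ∃ u ≤ t, IsLeast {s | E.InView S r v s ∧ P s} u := by
  obtain ⟨⟨τ, hτt, hτ⟩, he⟩ := hv
  obtain ⟨u, hut, hu⟩ := hE.exists_isLeast hr
    (P := fun s => ¬ E.HasEvidence S r v s ∧ P s)
    (fun s s' h hs => ⟨fun h' => hs.1 ((Run.hasEvidence_congr h).2 h'), hP s s' h hs.2⟩)
    hτt ⟨he, ht⟩
  refine ⟨u, hut, ?_⟩
  convert hu using 1
  ext s
  constructor
  · rintro ⟨⟨⟨τ', h1, h2⟩, h3⟩, h4⟩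
    exact ⟨(hτ.unique h2).le.trans h1, h3, h4⟩
  · rintro ⟨h1, h3, h4⟩
    exact ⟨hτ.inView h1 h3, h4⟩

/-- Whoever quits a view makes all honest nodes have the evidence within `Δ`. -/
theorem IsExecution.hasEvidence_of_quitsAt (hE : IsExecution S E) (hr : r ∈ E.honest)
    (hj : j ∈ E.honest) {t : ℝ} (h : E.QuitsAt S r v t) :
    E.HasEvidence S j v (t + S.Δ) := by
  have aux : ∀ e k, S.Proves v e → E.Sends S r (.quitView e v k) j t →
      E.HasEvidence S j v (t + S.Δ) := by
    intro e k he hs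
    obtain ⟨s, -, hs, hrecv⟩ := hE.synchrony r hr j hj _ t hs
    exact ⟨e, he, fun m hm => ((Run.Knows.of_recv hrecv).of_mem_parts (.inr hm)).mono hs⟩
  by_cases hq : E.GotQuitView S r v t
  · obtain ⟨e, k, he, hk⟩ := hq
    exact aux e k he (.inr ⟨h, he, hk⟩)
  · exact aux _ r (hE.quitEvidence_spec r hr v t h).1 (.inl ⟨⟨rfl, h, hq, rfl⟩, trivial⟩)

/-- Honest nodes enter a view within `Δ` of each other. -/
theorem IsExecution.exists_entersAt_le (hE : IsExecution S E) (hr : r ∈ E.honest)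
    (hj : j ∈ E.honest) {t : ℝ} (h : E.EntersAt S r v t) :
    ∃ s ≤ t + S.Δ, E.EntersAt S j v s := by
  have h1 := h.one_le
  induction v, h1 using Nat.le_induction generalizing t with
  | base =>
    refine ⟨0, ?_, rfl⟩
    have h0 : t = 0 := h
    rw [h0, zero_add]
    exact S.Δ_pos.le
  | succ v hv ih =>
    obtain ⟨τ, hτ, hl⟩ := (Run.entersAt_succ hv).1 h
    obtain ⟨s, hs, hsj⟩ := ih hτ
    exact hE.enters_succ hj hsj (hs.trans (by linarith [hl.1.1]))
      (hE.hasEvidence_of_quitsAt hr hj ⟨hv, h⟩)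

/-- Honest votes are cast in the view that they name. -/
theorem Run.Signs.inView_of_vote {T : Option (IdBlock D)} {k : Node f} {t : ℝ}
    (h : E.Signs S r t (.vote T v k)) : E.InView S r v t := by
  obtain ⟨-, ⟨I, -, hI⟩ | ⟨m, rfl, -, hm⟩⟩ := h
  · exact hI.1.1
  · exact hm.1.1

end Views

/-! ### The chain of an honest leader -/

section HonestLeader

variable {f : ℕ} {Req D F W : Type*} [Field F] [AddCommGroup W] [Module F W]
  {S : System f Req D F W} {E : Run f Req D W} {r j : Node f} {v k : ℕ}

variable (S E) in
/-- The identifier block of the `k`-th proposal of the leader of view `v`, if it is honest. -/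
def Run.proposedId (v k : ℕ) : IdBlock D where
  height := tipHeight (E.chain S v k) + 1
  root := S.blockRoot ⟨E.batch v k, (E.chain S v k).map IdBlock.root⟩
  prev := (E.chain S v k).map S.hashId

variable (S E) in
/-- The `k`-th proposal of the leader of view `v`, if it is honest, tailored for node `i`. -/
def Run.proposalFor (v k : ℕ) (i : Node f) : Proposal f D W where
  seg := ⟨i, S.encode (S.split (E.block S v k)) i, E.proposedId S v k⟩
  view := v
  cert := E.proposalCert S v k

theorem Run.chain_succ : E.chain S v (k + 1) = some (E.proposedId S v k) := rfl

theorem Run.proposedId_follows : S.Follows (E.proposedId S v k) (E.chain S v k) := ⟨rfl, rfl⟩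

theorem Run.isProposal_proposalFor (i : Node f) : E.IsProposal S v k (E.proposalFor S v k i) :=
  ⟨rfl, rfl, rfl, rfl⟩

theorem Run.tipHeight_chain : tipHeight (E.chain S v k) = tipHeight (E.newViewCert v).tip + k := by
  induction k with
  | zero => rfl
  | succ k ih =>
    rw [Run.chain_succ, ← add_assoc, ← ih]
    rfl

theorem Run.height_proposedId :
    (E.proposedId S v k).height = tipHeight (E.newViewCert v).tip + k + 1 :=
  congrArg (· + 1) Run.tipHeight_chain

theorem Run.proposedId_injective : Function.Injective (E.proposedId S v) := by
  intro a b h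
  have := congrArg IdBlock.height h
  simp only [Run.height_proposedId] at this
  omega

theorem Run.chain_extends {i : ℕ} {B : IdBlock D} (hB : E.chain S v i = some B) (hik : i ≤ k) :
    ∃ A, E.chain S v k = some A ∧ S.Extends A B := by
  induction k, hik using Nat.le_induction with
  | base => exact ⟨B, hB, .refl B⟩
  | succ k hk ih =>
    obtain ⟨A, hA, hAB⟩ := ih
    exact ⟨_, Run.chain_succ, .step (hA ▸ Run.proposedId_follows) hAB⟩

theorem Run.chain_extendsTip {i : ℕ} (hik : i ≤ k) :
    S.ExtendsTip (E.chain S v k) (E.chain S v i) := by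
  rcases hB : E.chain S v i with _ | B
  · simp [System.ExtendsTip]
  · obtain ⟨A, hA, hAB⟩ := Run.chain_extends hB hik
    rw [hA]
    exact hAB

theorem IsExecution.isProposal_of_knows (hE : IsExecution S E) (hL : leader f v ∈ E.honest)
    (hr : r ∈ E.honest) {p : Proposal f D W} (hp : p.view = v) {t : ℝ}
    (h : E.Knows r (.proposal p) t) :
    ∃ k, E.IsProposal S v k p ∧ ∃ s < t, E.ProposesAt S v k s := by
  subst hp
  obtain ⟨s, hs, -, k, hk, hp⟩ := hE.unforgeable r hr _ t h hL
  exact ⟨k, hp, s, hs, hk⟩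

theorem IsExecution.tip_eq_chain_of_knows (hE : IsExecution S E) (hL : leader f v ∈ E.honest)
    (hr : r ∈ E.honest) {a : LeaderMsg f D W} (ha : a.view = v) {t : ℝ}
    (h : ∀ m ∈ a.parts, E.Knows r m t) : ∃ k, a.tip = E.chain S v k := by
  cases a with
  | proposal p =>
    obtain ⟨k, hk, -⟩ := hE.isProposal_of_knows hL hr ha (h (.proposal p) (.inl rfl))
    exact ⟨k + 1, hk.2.2.1⟩
  | newView m =>
    obtain rfl : m.view = v := ha
    obtain ⟨s, -, -, -, hm⟩ := hE.unforgeable r hr (.newView m) t (h _ (.inl rfl)) hL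
    exact ⟨0, congrArg Cert.tip hm⟩

/-- Evidence against an honest leader can only consist of blames: its messages are linearly
ordered, and its segments decode to the block that it encoded. -/
theorem IsExecution.exists_blamesAt_of_hasEvidence (hE : IsExecution S E)
    (hL : leader f v ∈ E.honest) (hr : r ∈ E.honest) {t : ℝ} (h : E.HasEvidence S r v t) :
    ∃ j ∈ E.honest, ∃ s < t, E.BlamesAt S j v s := by
  obtain ⟨e, he, hk⟩ := h
  cases e with
  | equivocation a b =>
    exfalso
    obtain ⟨ha, hb, -, -, hab, hba⟩ := he
    obtain ⟨i, hi⟩ := hE.tip_eq_chain_of_knows hL hr ha fun m hm => hk m (.inl hm)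
    obtain ⟨l, hl⟩ := hE.tip_eq_chain_of_knows hL hr hb fun m hm => hk m (.inr hm)
    rw [hi, hl] at hab hba
    rcases le_total i l with h | h
    · exact hba (Run.chain_extendsTip h)
    · exact hab (Run.chain_extendsTip h)
  | error ps =>
    exfalso
    obtain ⟨I, x, ⟨hps, hinj, hx⟩, hroot⟩ := he
    have hp : ∀ a, ∃ k, E.IsProposal S v k (ps a) := fun a =>
      (hE.isProposal_of_knows hL hr (hps a).1
        (hk _ (Set.mem_iUnion.2 ⟨a, .inl rfl⟩))).imp fun _ h => h.1
    choose k hk using hp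
    have hI : ∀ a, I = E.proposedId S v (k a) := fun a => by
      have := (hk a).2.2.1
      rw [(hps a).2.2, Run.chain_succ] at this
      exact Option.some.inj this
    have hk0 : ∀ a, k a = k 0 := fun a => Run.proposedId_injective ((hI a).symm.trans (hI 0))
    have hxy : x = S.split (E.block S v (k 0)) :=
      System.eq_of_encode_eq ⟨_, hinj⟩ fun a => by
        rw [← hk0 a]
        exact (hx a).symm.trans (hk a).2.2.2
    rw [hxy, hI 0] at hroot
    exact hroot rfl
  | silence w bl =>
    obtain ⟨rfl, hc⟩ := he
    obtain ⟨j, hj, hjh⟩ := hE.exists_honest_mem hc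
    obtain ⟨s, hs, -, hb⟩ := hE.unforgeable r hr (.blame w j) t (hk _ ⟨j, hj, rfl⟩) hjh
    exact ⟨j, hjh, s, hs, hb⟩

/-! ### The pace of an honest leader -/

/-- The first honest vote in a view of an honest leader answers its new-view message, as a proposal
presupposes honest votes in the view. -/
theorem IsExecution.exists_newViewAt_of_vote (hE : IsExecution S E) (hL : leader f v ∈ E.honest)
    (hr : r ∈ E.honest) (hj : j ∈ E.honest) {T : Option (IdBlock D)} {t : ℝ}
    (h : E.Knows r (.vote T v j) t) : ∃ s < t, E.NewViewAt S v s := by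
  have step : ∀ r ∈ E.honest, ∀ t, (∃ T, ∃ j ∈ E.honest, E.Knows r (.vote T v j) t) →
      (∃ s < t, E.NewViewAt S v s) ∨ ∃ s < t, E.InView S (leader f v) v s ∧
        ∃ T, ∃ j ∈ E.honest, E.Knows (leader f v) (.vote T v j) s := by
    rintro r hr t ⟨T, j, hj, h⟩
    obtain ⟨s, hst, -, ⟨I, -, hI⟩ | ⟨m, rfl, -, hm⟩⟩ := hE.unforgeable r hr _ t h hj
    · obtain ⟨-, ps, x, hd, -, hk⟩ := hI.1
      obtain ⟨k, -, u, hu, ⟨hv, c, hcv, -, hc, -, hcert⟩, -⟩ :=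
        hE.isProposal_of_knows hL hj (hd.1 0).1 (hk 0)
      obtain ⟨i, hi, hik, -⟩ := hE.exists_honest_vote hL hc hcert
      exact .inr ⟨u, hu.trans hst, hv, _, i, hi, hcv ▸ hik⟩
    · obtain ⟨u, hu, -, hn, -⟩ := hE.unforgeable j hj _ s hm.1.2.2.2 hL
      exact .inl ⟨u, hu.trans hst, hn⟩
  rcases step r hr t ⟨T, j, hj, h⟩ with h | ⟨s, hst, hv, hs⟩
  · exact h
  obtain ⟨u, hus, hu⟩ := hE.exists_isLeast_inView hL
    (P := fun s => ∃ T, ∃ j ∈ E.honest, E.Knows (leader f v) (.vote T v j) s)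
    (fun s s' h hs => by simpa only [h] using hs) hv hs
  rcases step _ hL u hu.1.2 with ⟨w, hw, hn⟩ | ⟨w, hw, hw'⟩
  · exact ⟨w, (hw.trans_le hus).trans hst, hn⟩
  · exact absurd (hu.2 hw') hw.not_ge

/-- The certificates that an honest leader knows `2 Δ` after entering its view are from earlier
views. -/
theorem IsExecution.cert_view_lt (hE : IsExecution S E) (hL : leader f v ∈ E.honest) {τ : ℝ}
    (hτ : E.EntersAt S (leader f v) v τ)
    (hN : ∀ r ∈ E.honest, ¬ E.HasEvidence S r v (τ + 2 * S.Δ)) {c : Cert f D}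
    (hc : E.HasCert (leader f v) c (τ + 2 * S.Δ)) : c.view < v := by
  obtain ⟨rfl | hcard, hk⟩ := hc
  · exact hτ.one_le
  obtain ⟨j, hj, hkj, s, hs, hsig⟩ := hE.exists_honest_vote hL hcard hk
  rcases lt_trichotomy c.view v with h | h | h
  · exact h
  · rw [h] at hkj
    obtain ⟨u, hu, hn⟩ := hE.exists_newViewAt_of_vote hL hL hj hkj
    have := hn.2.unique hτ
    linarith
  · obtain ⟨⟨w, hw, hent⟩, -⟩ := hsig.inView_of_vote
    exact absurd ((hent.exists_of_lt hτ.one_le h).2.mono (hw.trans hs.le)) (hN j hj)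

/-- The status messages reach an honest leader before it chooses its new-view certificate. -/
theorem IsExecution.lock_rank_le (hE : IsExecution S E) (hL : leader f v ∈ E.honest)
    (hr : r ∈ E.honest) {τ : ℝ} (hτ : E.EntersAt S (leader f v) v τ)
    (hn : E.NewViewAt S v (τ + 2 * S.Δ)) : (E.lock r v).rank ≤ (E.newViewCert v).rank := by
  obtain ⟨s, hs, hent⟩ := hE.exists_entersAt_le hL hr hτ
  obtain ⟨u, -, hu, hrecv⟩ := hE.synchrony r hr _ hL (.status (E.lock r v) v r) s
    (.inl ⟨⟨rfl, hent, rfl⟩, rfl⟩)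
  refine (hE.newViewCert_spec v hL _ hn).2 _ ⟨(hE.lock_spec r hr v s hent).1.1, fun m hm => ?_⟩
  exact ((Run.Knows.of_recv hrecv).of_mem_parts (.inr hm)).mono (by linarith)

theorem IsExecution.inView_of_leader_entersAt (hE : IsExecution S E) (hL : leader f v ∈ E.honest)
    (hr : r ∈ E.honest) {τ t : ℝ} (hτ : E.EntersAt S (leader f v) v τ) (ht : τ + S.Δ ≤ t)
    (hN : ∀ r ∈ E.honest, ¬ E.HasEvidence S r v t) : E.InView S r v t := by
  obtain ⟨s, hs, hent⟩ := hE.exists_entersAt_le hL hr hτ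
  exact hent.inView (hs.trans ht) (hN r hr)

/-- Without evidence, all honest nodes accept the new-view message of an honest leader within
`3 Δ`. -/
theorem IsExecution.exists_acceptsAt (hE : IsExecution S E) (hL : leader f v ∈ E.honest)
    (hr : r ∈ E.honest) {τ : ℝ} (hτ : E.EntersAt S (leader f v) v τ)
    (hN : ∀ r ∈ E.honest, ¬ E.HasEvidence S r v (τ + 3 * S.Δ)) :
    ∃ t ≤ τ + 3 * S.Δ, E.AcceptsAt S r ⟨v, E.newViewCert v⟩ t := by
  have hΔ := S.Δ_pos
  have hN2 : ∀ r ∈ E.honest, ¬ E.HasEvidence S r v (τ + 2 * S.Δ) :=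
    fun r hr h => hN r hr (h.mono (by linarith))
  have hn : E.NewViewAt S v (τ + 2 * S.Δ) :=
    ⟨hE.inView_of_leader_entersAt hL hL hτ (by linarith) hN2, by simpa using hτ⟩
  obtain ⟨s, -, hs, hrecv⟩ := hE.synchrony _ hL r hr (.newView ⟨v, E.newViewCert v⟩) _
    (.inl ⟨⟨rfl, hn, rfl⟩, trivial⟩)
  have hcert := (hE.newViewCert_spec v hL _ hn).1
  exact hE.exists_isLeast_inView hr
    (P := fun s => LegalNewView ⟨v, E.newViewCert v⟩ ∧ (E.lock r v).rank ≤ (E.newViewCert v).rank ∧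
      E.Knows r (.newView ⟨v, E.newViewCert v⟩) s)
    (fun s s' h hs => by simpa only [h] using hs)
    (hE.inView_of_leader_entersAt hL hr hτ (by linarith) hN)
    ⟨⟨hcert.1, hE.cert_view_lt hL hτ hN2 hcert⟩, hE.lock_rank_le hL hr hτ hn,
      (Run.Knows.of_recv hrecv).mono (by linarith)⟩

theorem IsExecution.exists_proposesAt_of_votes (hE : IsExecution S E)
    (hL : leader f v ∈ E.honest) {t : ℝ} (hv : E.InView S (leader f v) v (t + S.Δ))
    (h : ∀ r ∈ E.honest, ∃ s ≤ t, E.Signs S r s (.vote (E.chain S v k) v r)) :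
    ∃ u ≤ t + S.Δ, E.ProposesAt S v k u := by
  obtain ⟨q, hq, hc⟩ := hE.exists_quorum
  refine hE.exists_isLeast_inView hL
    (P := fun s => ∃ c, c.view = v ∧ c.tip = E.chain S v k ∧ c.signers.card = f + 1 ∧
      E.HasCert (leader f v) c s)
    (fun s s' h hs => by simpa only [Run.HasCert, h] using hs)
    hv ⟨⟨v, E.chain S v k, q⟩, rfl, rfl, hc, .inr hc, ?_⟩
  rintro _ ⟨j, hj, rfl⟩
  obtain ⟨s, hs, hsig⟩ := h j (hq hj)
  obtain ⟨u, -, hu, hrecv⟩ := hE.synchrony j (hq hj) _ hL _ s (.inl ⟨hsig, trivial⟩)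
  exact (Run.Knows.of_recv hrecv).mono (by linarith)

theorem IsExecution.legal_proposalFor (hE : IsExecution S E) (hL : leader f v ∈ E.honest) {t : ℝ}
    (h : E.ProposesAt S v k t) (i : Node f) : S.LegalProposal (E.proposalFor S v k i) :=
  ⟨rfl, (hE.proposalSigners_spec v hL k t h).1, Run.proposedId_follows⟩

theorem IsExecution.knows_proposalFor (hE : IsExecution S E) (hL : leader f v ∈ E.honest)
    (hr : r ∈ E.honest) {t : ℝ} (h : E.ProposesAt S v k t) :
    E.Knows r (.proposal (E.proposalFor S v k r)) (t + S.Δ) := by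
  obtain ⟨s, -, hs, hrecv⟩ := hE.synchrony _ hL r hr (.proposal (E.proposalFor S v k r)) t
    (.inl ⟨⟨rfl, k, h, Run.isProposal_proposalFor r⟩, rfl⟩)
  exact (Run.Knows.of_recv hrecv).mono hs

/-- Without evidence, the nodes exchange the segments of a proposal and vote within `2 Δ`. -/
theorem IsExecution.exists_votesAt_of_proposesAt (hE : IsExecution S E)
    (hL : leader f v ∈ E.honest) (hr : r ∈ E.honest) {τ t u : ℝ}
    (hτ : E.EntersAt S (leader f v) v τ) (ht : τ ≤ t)
    (hN : ∀ r ∈ E.honest, ¬ E.HasEvidence S r v (t + 2 * S.Δ)) (hut : u ≤ t)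
    (h : E.ProposesAt S v k u) :
    ∃ s ≤ t + 2 * S.Δ, E.VotesAt S r v (E.proposedId S v k) s := by
  have hΔ := S.Δ_pos
  have hN1 : ∀ r ∈ E.honest, ¬ E.HasEvidence S r v (t + S.Δ) :=
    fun r hr h => hN r hr (h.mono (by linarith))
  -- Every honest node reproposes the segment tailored for it.
  have key : ∀ j ∈ E.honest, E.Knows r (.proposal (E.proposalFor S v k j)) (t + 2 * S.Δ) := by
    intro j hj
    have hk := (hE.knows_proposalFor hL hj h).mono (t := t + S.Δ) (by linarith)
    obtain ⟨w, hw, hleast⟩ := hE.exists_isLeast_inView hj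
      (P := fun s => E.Knows j (.proposal (E.proposalFor S v k j)) s)
      (fun s s' h hs => (h _).1 hs)
      (hE.inView_of_leader_entersAt hL hj hτ (by linarith) hN1) hk
    obtain ⟨s, -, hs, hrecv⟩ := hE.synchrony j hj r hr (.proposal (E.proposalFor S v k j)) w
      (.inr ⟨hE.legal_proposalFor hL h j, hleast.1.2, .inr ⟨rfl, hleast⟩⟩)
    exact (Run.Knows.of_recv hrecv).mono (by linarith)
  obtain ⟨e, he⟩ := hE.exists_quorum_embedding
  exact hE.exists_isLeast_inView hr
    (P := fun s => ∃ ps x, S.DecodesTo v (E.proposedId S v k) ps x ∧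
      S.merkleRoot x = (E.proposedId S v k).root ∧ ∀ a, E.Knows r (.proposal (ps a)) s)
    (fun s s' h hs => by simpa only [h] using hs)
    (hE.inView_of_leader_entersAt hL hr hτ (by linarith) hN)
    ⟨fun a => E.proposalFor S v k (e a), S.split (E.block S v k),
      ⟨fun a => ⟨rfl, hE.legal_proposalFor hL h _, rfl⟩, e.injective, fun a => rfl⟩, rfl,
      fun a => key _ (he a)⟩

/-- Without evidence, an honest leader makes a proposal every `3 Δ`. -/
theorem IsExecution.exists_proposesAt (hE : IsExecution S E) (hL : leader f v ∈ E.honest) {τ : ℝ}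
    (hτ : E.EntersAt S (leader f v) v τ) (k : ℕ)
    (hN : ∀ r ∈ E.honest, ¬ E.HasEvidence S r v (τ + (3 * k + 4) * S.Δ)) :
    ∃ t ≤ τ + (3 * k + 4) * S.Δ, E.ProposesAt S v k t := by
  have hΔ := S.Δ_pos
  induction k with
  | zero =>
    have e : τ + (3 * ((0 : ℕ) : ℝ) + 4) * S.Δ = τ + 3 * S.Δ + S.Δ := by push_cast; ring
    rw [e] at hN ⊢
    refine hE.exists_proposesAt_of_votes hL
      (hE.inView_of_leader_entersAt hL hL hτ (by linarith) hN) fun r hr => ?_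
    obtain ⟨s, hs, hacc⟩ := hE.exists_acceptsAt hL hr hτ
      fun r hr h => hN r hr (h.mono (by linarith))
    exact ⟨s, hs, rfl, .inr ⟨_, rfl, rfl, hacc⟩⟩
  | succ k ih =>
    have e : τ + (3 * ((k + 1 : ℕ) : ℝ) + 4) * S.Δ
        = τ + (3 * k + 4) * S.Δ + 2 * S.Δ + S.Δ := by push_cast; ring
    have hpos : 0 ≤ (3 * (k : ℝ) + 4) * S.Δ := by positivity
    rw [e] at hN ⊢
    obtain ⟨u, hu, hprop⟩ := ih fun r hr h => hN r hr (h.mono (by linarith))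
    refine hE.exists_proposesAt_of_votes hL
      (hE.inView_of_leader_entersAt hL hL hτ (by linarith) hN) fun r hr => ?_
    obtain ⟨s, hs, hvote⟩ := hE.exists_votesAt_of_proposesAt hL hr hτ (by linarith)
      (fun r hr h => hN r hr (h.mono (by linarith))) hu hprop
    exact ⟨s, hs, rfl, .inl ⟨_, Run.chain_succ, hvote⟩⟩

/-- As long as no honest node has evidence, honest nodes vote in time. The leader may have entered
the view `Δ` after the node. -/
theorem IsExecution.le_encard_votedBy (hE : IsExecution S E) (hL : leader f v ∈ E.honest)
    (hr : r ∈ E.honest) {τ : ℝ} (hτ : E.EntersAt S r v τ) (p : ℕ)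
    (hN : ∀ r ∈ E.honest, ¬ E.HasEvidence S r v (τ + (3 * p + 4) * S.Δ)) :
    (p : ℕ∞) ≤ (E.votedBy S r v (τ + (3 * p + 4) * S.Δ)).encard := by
  have hΔ := S.Δ_pos
  obtain ⟨τ', hτ', hent⟩ := hE.exists_entersAt_le hr hL hτ
  have hsub : E.proposedId S v '' (Finset.range p : Set ℕ) ⊆
      E.votedBy S r v (τ + (3 * p + 4) * S.Δ) := by
    rintro _ ⟨k, hk, rfl⟩
    have hkp : (k : ℝ) + 1 ≤ p := by exact_mod_cast Finset.mem_range.1 (Finset.mem_coe.1 hk)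
    have hle : τ' + (3 * k + 4) * S.Δ + 2 * S.Δ ≤ τ + (3 * p + 4) * S.Δ := by nlinarith
    have hpos : 0 ≤ (3 * (k : ℝ) + 4) * S.Δ := by positivity
    obtain ⟨u, hu, hprop⟩ := hE.exists_proposesAt hL hent k
      fun r hr h => hN r hr (h.mono (by linarith))
    obtain ⟨s, hs, hvote⟩ := hE.exists_votesAt_of_proposesAt hL hr hent (by linarith)
      (fun r hr h => hN r hr (h.mono hle)) hu hprop
    exact ⟨s, hs.trans hle, hvote⟩
  refine le_trans ?_ (Set.encard_le_encard hsub)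
  rw [Run.proposedId_injective.encard_image, Set.encard_coe_eq_coe_finsetCard, Finset.card_range]

/-- Nobody ever has evidence against an honest leader: the first evidence would contain an earlier
honest blame, but until then honest nodes have voted in time. -/
theorem IsExecution.not_hasEvidence (hE : IsExecution S E) (hL : leader f v ∈ E.honest)
    (hr : r ∈ E.honest) (t : ℝ) : ¬ E.HasEvidence S r v t := by
  -- At the time of a blame, some honest node has evidence: otherwise the blamer has voted in time.
  have step : ∀ i ∈ E.honest, ∀ s, E.BlamesAt S i v s →
      ∃ j ∈ E.honest, E.HasEvidence S j v s := by
    rintro i hi s ⟨-, τ, hτ, p, -, rfl, hlt⟩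
    by_contra! hN
    exact (hE.le_encard_votedBy hL hi hτ p hN).not_gt hlt
  intro h
  obtain ⟨i, hi, s, -, hb⟩ := hE.exists_blamesAt_of_hasEvidence hL hr h
  obtain ⟨τ₀, -, hτ₀⟩ := hb.1.1
  -- Blames are made in the view, hence not before `τ₀ - Δ`.
  have hlow : ∀ j ∈ E.honest, ∀ s, E.BlamesAt S j v s → τ₀ - S.Δ ≤ s := by
    rintro j hj s ⟨⟨⟨τ, hτs, hτ⟩, -⟩, -⟩
    obtain ⟨w, hw, hw'⟩ := hE.exists_entersAt_le hj hi hτ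
    have := hw'.unique hτ₀
    linarith
  -- The first time of evidence, for each honest node that has some.
  have hfirst : ∀ j ∈ E.honest, ∀ t, E.HasEvidence S j v t →
      ∃ u ≤ t, IsLeast {s | τ₀ - S.Δ ≤ s ∧ E.HasEvidence S j v s} u := by
    intro j hj t ht
    obtain ⟨i, hi, s, hs, hb⟩ := hE.exists_blamesAt_of_hasEvidence hL hj ht
    exact hE.exists_isLeast hj (P := fun s => E.HasEvidence S j v s)
      (fun s s' h => (Run.hasEvidence_congr h).1) ((hlow i hi s hb).trans hs.le) ht
  obtain ⟨u₀, -, hu₀⟩ := hfirst r hr t h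
  set U : Set ℝ := {u | ∃ j ∈ E.honest,
    IsLeast {s | τ₀ - S.Δ ≤ s ∧ E.HasEvidence S j v s} u} with hU
  have hUfin : U.Finite := by
    have : U = ⋃ j ∈ (E.honest : Set (Node f)),
        {u | IsLeast {s | τ₀ - S.Δ ≤ s ∧ E.HasEvidence S j v s} u} := by
      ext u
      simp [hU]
    rw [this]
    exact E.honest.finite_toSet.biUnion fun j _ =>
      Set.Subsingleton.finite fun a ha b hb => ha.unique hb
  obtain ⟨u, ⟨j, hj, hu⟩, hmin⟩ := Set.exists_min_image U id hUfin ⟨u₀, r, hr, hu₀⟩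
  obtain ⟨i', hi', s', hs', hb'⟩ := hE.exists_blamesAt_of_hasEvidence hL hj hu.1.2
  obtain ⟨l, hl, hls⟩ := step i' hi' s' hb'
  obtain ⟨w, hw, hwl⟩ := hfirst l hl s' hls
  exact absurd (hmin w ⟨l, hl, hwl⟩) (not_le.2 (hw.trans_lt hs'))

end HonestLeader

/-! ### Ancestry of certified blocks -/

section Ancestry

variable {f : ℕ} {Req D F W : Type*} [Field F] [AddCommGroup W] [Module F W]
  {S : System f Req D F W} {E : Run f Req D W} {r : Node f}

/-- A certified identifier block has ancestors at all lower heights. An honest voter has seen either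
a proposal that carries the certificate of the predecessor in the same view, or a certificate of the
block itself from an earlier view, so the ranks decrease. -/
theorem IsExecution.exists_ancestor (hE : IsExecution S E) (hr : r ∈ E.honest) {c : Cert f D}
    {I : IdBlock D} (hI : c.tip = some I) (hc : c.signers.card = f + 1) {t : ℝ}
    (hk : ∀ m ∈ c.parts, E.Knows r m t) {h : ℕ} (h1 : 1 ≤ h) (hh : h ≤ I.height) :
    ∃ J, S.Extends I J ∧ J.height = h := by
  induction hw : c.view using Nat.strong_induction_on generalizing r c I t with
  | _ w ihw =>
  induction hn : I.height using Nat.strong_induction_on generalizing r c I t with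
  | _ n ihn =>
  subst hw hn
  rcases hh.eq_or_lt with rfl | hlt
  · exact ⟨I, .refl I, rfl⟩
  obtain ⟨j, hj, -, s, -, -, ⟨I', hI', hvote⟩ | ⟨m, hm, htip, hacc⟩⟩ :=
    hE.exists_honest_vote hr hc hk
  · obtain rfl : I = I' := Option.some.inj (hI.symm.trans hI')
    obtain ⟨-, ps, x, hd, -, hps⟩ := hvote.1
    obtain ⟨hview, ⟨hcv, hcard, hfol⟩, hid⟩ := hd.1 0
    rw [hid] at hfol
    rcases hT : (ps 0).cert.tip with _ | B
    · have := hfol.2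
      rw [hT] at this
      simp only [tipHeight] at this
      omega
    · rw [hT] at hfol
      have hheight := hfol.2
      simp only [tipHeight] at hheight
      obtain ⟨J, hJ, hJh⟩ := ihn B.height (by omega) hj hT hcard
        (Run.knows_cert_of_proposal (hps 0)) (by omega) (hcv.trans hview) rfl
      exact ⟨J, .step hfol hJ, hJh⟩
  · obtain ⟨-, ⟨hvalid, hlt'⟩, -, hkm⟩ := hacc.1
    have hmI := htip.trans hI
    rcases hvalid with hg | hcard
    · rw [hg] at hmI
      exact absurd hmI (by simp [genesis])
    · exact ihw m.cert.view (hm ▸ hlt') hj hmI hcard (Run.knows_cert_of_newView hkm) hh rfl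

end Ancestry

/-! ### The final view -/

section FinalView

variable {f : ℕ} {Req D F W : Type*} [Field F] [AddCommGroup W] [Module F W]
  {S : System f Req D F W} {E : Run f Req D W} {r j : Node f} {v : ℕ}

variable (S E) in
/-- All honest nodes enter view `v` and never have evidence to leave it. -/
structure Run.IsFinal (v : ℕ) : Prop where
  enters : ∀ r ∈ E.honest, ∃ τ, E.EntersAt S r v τ
  not_hasEvidence : ∀ r ∈ E.honest, ∀ t, ¬ E.HasEvidence S r v t

theorem IsExecution.isFinal_of_leader_mem (hE : IsExecution S E) (hL : leader f v ∈ E.honest)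
    (hr : r ∈ E.honest) {τ : ℝ} (hτ : E.EntersAt S r v τ) : E.IsFinal S v where
  enters _ hj := (hE.exists_entersAt_le hr hj hτ).imp fun _ h => h.2
  not_hasEvidence _ hj := hE.not_hasEvidence hL hj

/-- View changes stop at the latest in the first view of an honest leader. -/
theorem IsExecution.exists_isFinal (hE : IsExecution S E) : ∃ v, E.IsFinal S v := by
  obtain ⟨e, he⟩ := hE.exists_quorum_embedding
  by_contra! hno
  have hall : ∀ v : ℕ, ∃ τ, E.EntersAt S (e 0) (v + 1) τ := by
    intro v
    induction v with
    | zero => exact ⟨0, rfl⟩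
    | succ v ih =>
      obtain ⟨τ, hτ⟩ := ih
      by_contra! hstay
      refine hno (v + 1) ⟨fun j hj => (hE.exists_entersAt_le (he 0) hj hτ).imp fun _ h => h.2,
        fun j hj t hev => ?_⟩
      obtain ⟨s, -, hs⟩ := hE.exists_entersAt_le (he 0) hj hτ
      obtain ⟨u, -, hu⟩ := hE.enters_succ hj hs (le_max_left s t) (hev.mono (le_max_right s t))
      obtain ⟨w, -, hw⟩ := hE.exists_entersAt_le hj (he 0) hu
      exact hstay w hw
  -- The number of a node, increased by `n` to be positive, is a view that this node leads.
  obtain ⟨τ, hτ⟩ := hall ((e 0 : ℕ) + 2 * f)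
  refine hno _ (hE.isFinal_of_leader_mem ?_ (he 0) hτ)
  have : leader f ((e 0 : ℕ) + 2 * f + 1) = e 0 := by
    apply Fin.ext
    simp only [leader, add_assoc, Nat.add_mod_right]
    exact Nat.mod_eq_of_lt (e 0).isLt
  rw [this]
  exact he 0

theorem Run.IsFinal.exists_inView (hv : E.IsFinal S v) (hr : r ∈ E.honest) :
    ∃ τ, ∀ t, τ ≤ t → E.InView S r v t :=
  (hv.enters r hr).imp fun _ hτ _ ht => hτ.inView ht (hv.not_hasEvidence r hr _)

/-- In the final view, a node knows only proposals that extend one another. -/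
theorem Run.IsFinal.extends_or_extends (hv : E.IsFinal S v) (hr : r ∈ E.honest)
    {p q : Proposal f D W} (hp : S.LegalProposal p) (hpv : p.view = v) {s t : ℝ}
    (hpk : E.Knows r (.proposal p) s) (hq : S.LegalProposal q) (hqv : q.view = v)
    (hqk : E.Knows r (.proposal q) t) :
    S.Extends p.seg.id q.seg.id ∨ S.Extends q.seg.id p.seg.id := by
  by_contra! h
  refine hv.not_hasEvidence r hr (max s t)
    ⟨.equivocation (.proposal p) (.proposal q), ⟨hpv, hqv, hp, hq, h.1, h.2⟩, ?_⟩
  rintro m (hm | hm)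
  · exact (hpk.of_mem_parts hm).mono (le_max_left s t)
  · exact (hqk.of_mem_parts hm).mono (le_max_right s t)

theorem Run.IsFinal.id_eq_of_height_eq (hv : E.IsFinal S v) (hr : r ∈ E.honest)
    {p q : Proposal f D W} (hp : S.LegalProposal p) (hpv : p.view = v) {s t : ℝ}
    (hpk : E.Knows r (.proposal p) s) (hq : S.LegalProposal q) (hqv : q.view = v)
    (hqk : E.Knows r (.proposal q) t) (hh : p.seg.id.height = q.seg.id.height) :
    p.seg.id = q.seg.id := by
  rcases hv.extends_or_extends hr hp hpv hpk hq hqv hqk with h | h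
  · exact h.eq_of_height_eq hh
  · exact (h.eq_of_height_eq hh.symm).symm

/-- Re-proposing brings every identifier block proposed to an honest node in the final view to all
honest nodes. -/
theorem IsExecution.exists_knows_proposal (hE : IsExecution S E) (hv : E.IsFinal S v)
    (hr : r ∈ E.honest) (hj : j ∈ E.honest) {p : Proposal f D W} (hp : S.LegalProposal p)
    (hpv : p.view = v) {t : ℝ} (hk : E.Knows r (.proposal p) t) :
    ∃ q s, S.LegalProposal q ∧ q.view = v ∧ q.seg.id = p.seg.id ∧ E.Knows j (.proposal q) s := by
  obtain ⟨τ, hτ⟩ := hv.exists_inView hr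
  obtain ⟨u, -, hu⟩ := hE.exists_isLeast_inView hr
    (P := fun s => ∃ p', S.LegalProposal p' ∧ p'.view = v ∧
      p'.seg.id.height = p.seg.id.height ∧ E.Knows r (.proposal p') s)
    (fun s s' h hs => by simpa only [h] using hs) (hτ _ (le_max_left τ t))
    ⟨p, hp, hpv, rfl, hk.mono (le_max_right τ t)⟩
  obtain ⟨-, q, hq, hqv, hqh, hqk⟩ := hu.1
  obtain ⟨s, -, -, hrecv⟩ := hE.synchrony r hr j hj (.proposal q) u
    (.inr ⟨hq, hqk, .inl (by rwa [hqv, hqh])⟩)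
  exact ⟨q, s, hq, hqv, hv.id_eq_of_height_eq hr hq hqv hqk hp hpv hk hqh, .of_recv hrecv⟩

/-- If all honest nodes blamed the leader of the final view, this would be evidence. -/
theorem IsExecution.exists_not_blamesAt (hE : IsExecution S E) (hv : E.IsFinal S v) :
    ∃ r ∈ E.honest, ∀ t, ¬ E.BlamesAt S r v t := by
  by_contra! hall
  choose! b hb using hall
  obtain ⟨q, hq, hc⟩ := hE.exists_quorum
  obtain ⟨j, -, hj⟩ := hE.exists_honest_mem hc
  obtain ⟨M, hM⟩ := (q.finite_toSet.image b).bddAbove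
  refine hv.not_hasEvidence j hj (M + S.Δ) ⟨.silence v q, ⟨rfl, hc⟩, ?_⟩
  rintro _ ⟨i, hi, rfl⟩
  obtain ⟨s, -, hs, hrecv⟩ := hE.synchrony i (hq hi) j hj (.blame v i) (b i)
    (.inl ⟨⟨rfl, hb i (hq hi)⟩, trivial⟩)
  have : b i ≤ M := hM ⟨i, hi, rfl⟩
  exact (Run.Knows.of_recv hrecv).mono (by linarith)

/-- In the final view, proposals of arbitrary height reach every honest node: an honest node that
never blames votes for arbitrarily many identifier blocks, and these have different heights. -/
theorem IsExecution.exists_knows_proposal_height_ge (hE : IsExecution S E) (hv : E.IsFinal S v)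
    (hr : r ∈ E.honest) (h : ℕ) : ∃ p t, S.LegalProposal p ∧ p.view = v ∧
      h ≤ p.seg.id.height ∧ E.Knows r (.proposal p) t := by
  obtain ⟨j, hj, hnb⟩ := hE.exists_not_blamesAt hv
  obtain ⟨τ, hτ⟩ := hv.enters j hj
  set t := τ + (3 * ((h + 1 : ℕ) : ℝ) + 4) * S.Δ with ht
  have hτt : τ ≤ t := by
    have := S.Δ_pos
    rw [ht]
    have : 0 ≤ (3 * ((h + 1 : ℕ) : ℝ) + 4) * S.Δ := by positivity
    linarith
  have hcard : ((h + 1 : ℕ) : ℕ∞) ≤ (E.votedBy S j v t).encard := by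
    by_contra! hlt
    exact hnb t ⟨hτ.inView hτt (hv.not_hasEvidence j hj t), τ, hτ, h + 1, by omega, ht, hlt⟩
  have hseen : ∀ I ∈ E.votedBy S j v t, ∃ p s, S.LegalProposal p ∧ p.view = v ∧ p.seg.id = I ∧
      E.Knows j (.proposal p) s := by
    rintro I ⟨s, -, hs⟩
    obtain ⟨-, ps, x, hd, -, hk⟩ := hs.1
    exact ⟨ps 0, s, (hd.1 0).2.1, (hd.1 0).1, (hd.1 0).2.2, hk 0⟩
  have hinj : Set.InjOn IdBlock.height (E.votedBy S j v t) := by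
    intro I hI I' hI' hh
    obtain ⟨p, s, hp, hpv, rfl, hpk⟩ := hseen I hI
    obtain ⟨q, s', hq, hqv, rfl, hqk⟩ := hseen I' hI'
    exact hv.id_eq_of_height_eq hj hp hpv hpk hq hqv hqk hh
  obtain ⟨I, hI, hIh⟩ : ∃ I ∈ E.votedBy S j v t, h ≤ I.height := by
    by_contra! hlt
    have hsub : IdBlock.height '' E.votedBy S j v t ⊆ (Finset.range h : Set ℕ) := by
      rintro _ ⟨I, hI, rfl⟩
      simpa using hlt I hI
    have hle := Set.encard_le_encard hsub
    rw [hinj.encard_image, Set.encard_coe_eq_coe_finsetCard, Finset.card_range] at hle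
    have := hcard.trans hle
    rw [Nat.cast_le] at this
    omega
  obtain ⟨p, s, hp, hpv, rfl, hpk⟩ := hseen I hI
  obtain ⟨q, u, hq, hqv, hqid, hqk⟩ := hE.exists_knows_proposal hv hj hr hp hpv hpk
  exact ⟨q, u, hq, hqv, hqid ▸ hIh, hqk⟩

/-! ### Commits -/

/-- In the final view, every honest node directly commits identifier blocks of arbitrary height at
arbitrarily late times; each has a successor among the proposals that the node knows. -/
theorem IsExecution.exists_directlyCommitsAt (hE : IsExecution S E) (hv : E.IsFinal S v)
    (hr : r ∈ E.honest) (T : ℝ) (h : ℕ) : ∃ I t p, T ≤ t ∧ h ≤ I.height ∧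
      E.DirectlyCommitsAt S r I t ∧ S.LegalProposal p ∧ p.view = v ∧ p.cert.tip = some I ∧
      E.Knows r (.proposal p) t := by
  have hΔ := S.Δ_pos
  -- Above the height `H`, no proposal is known by time `T`.
  obtain ⟨H, hH⟩ : ∃ H, ∀ p : Proposal f D W, E.Knows r (.proposal p) T →
      p.seg.id.height ≤ H := by
    have hinj : Function.Injective (Msg.proposal : Proposal f D W → Msg f D W) :=
      fun _ _ h => Msg.proposal.inj h
    have hfin := ((hE.finite_known hr T).preimage hinj.injOn).image fun p => p.seg.id.height
    obtain ⟨H, hH⟩ := hfin.bddAbove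
    exact ⟨H, fun p hp => hH ⟨p, hp, rfl⟩⟩
  obtain ⟨p, t, hp, hpv, hph, hpk⟩ := hE.exists_knows_proposal_height_ge hv hr (max H h + 2)
  have hheight := hp.2.2.2
  rcases hI : p.cert.tip with _ | I
  · rw [hI] at hheight
    simp only [tipHeight] at hheight
    omega
  rw [hI] at hheight
  simp only [tipHeight] at hheight
  obtain ⟨τ, hτ⟩ := hv.exists_inView hr
  obtain ⟨s, -, hs⟩ := hE.exists_isLeast_inView hr
    (P := fun s => ∃ p, S.LegalProposal p ∧ p.view = v ∧ p.cert.tip = some I ∧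
      E.Knows r (.proposal p) s)
    (fun s s' h hs => by simpa only [h] using hs) (hτ _ (le_max_left τ t))
    ⟨p, hp, hpv, hI, hpk.mono (le_max_right τ t)⟩
  obtain ⟨⟨⟨σ, hσs, hσ⟩, -⟩, q, hq, hqv, hqI, hqk⟩ := hs.1
  have hTs : T < s := by
    by_contra! hle
    have h1 := hH q (hqk.mono hle)
    have h2 := hq.2.2.2
    rw [hqI] at h2
    simp only [tipHeight] at h2
    omega
  exact ⟨I, s + 2 * S.Δ, q, by linarith, by omega,
    ⟨v, s, hs, rfl, hσ.inView (by linarith) (hv.not_hasEvidence r hr _)⟩, hq, hqv, hqI,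
    hqk.mono (by linarith)⟩

/-- In the final view, every identifier block proposed to some honest node is committed by all. -/
theorem IsExecution.exists_committed_of_knows_proposal (hE : IsExecution S E)
    (hv : E.IsFinal S v) (hj : j ∈ E.honest) {p : Proposal f D W} (hp : S.LegalProposal p)
    (hpv : p.view = v) {s : ℝ} (hk : E.Knows j (.proposal p) s) (hr : r ∈ E.honest) :
    ∃ t, E.Committed S r p.seg.id t := by
  obtain ⟨q, u, hq, hqv, hqid, hqk⟩ := hE.exists_knows_proposal hv hj hr hp hpv hk
  obtain ⟨I, t, p', -, hIh, hI, hp', hpv', hpI', hpk'⟩ :=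
    hE.exists_directlyCommitsAt hv hr 0 p.seg.id.height
  have hfol := hp'.2.2
  rw [hpI'] at hfol
  have hheight := hfol.2
  simp only [tipHeight] at hheight
  refine ⟨t, I, t, le_rfl, hI, ?_⟩
  rw [← hqid] at hIh ⊢
  rcases hv.extends_or_extends hr hp' hpv' hpk' hq hqv hqk with h | h
  · exact h.of_follows (by omega) hfol
  · rcases h.eq_or_height_lt with h | h
    · rw [h] at hIh
      omega
    · omega

theorem IsExecution.exists_committedRequest (hE : IsExecution S E)
    (hv : E.IsFinal S v) (hj : j ∈ E.honest) {p : Proposal f D W} (hp : S.LegalProposal p)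
    (hpv : p.view = v) {s : ℝ} (hk : E.Knows j (.proposal p) s) {q : Req}
    (hq : S.ChainContains (some p.seg.id) q) (hr : r ∈ E.honest) :
    ∃ t, E.CommittedRequest S r q t := by
  obtain ⟨A, I, hA, hAI, hI⟩ := hq
  obtain ⟨t, J, u, hu, hJ, hJA⟩ := hE.exists_committed_of_knows_proposal hv hj hp hpv hk hr
  rw [Option.some.inj hA] at hJA
  exact ⟨t, I, ⟨J, u, hu, hJ, hJA.trans hAI⟩, hI⟩

theorem Run.contains_proposedId {k : ℕ} {q : Req} (hq : q ∈ E.batch v k) :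
    S.Contains (E.proposedId S v k) q :=
  ⟨E.block S v k, rfl, hq⟩

/-- An honest leader proposes a chain with any given request to itself. -/
theorem IsExecution.exists_proposal_chainContains (hE : IsExecution S E)
    (hL : leader f v ∈ E.honest) {τ : ℝ} (hτ : E.EntersAt S (leader f v) v τ) {q : Req}
    (hq : q ∈ E.requests) : ∃ p t, S.LegalProposal p ∧ p.view = v ∧
      S.ChainContains (some p.seg.id) q ∧ E.Knows (leader f v) (.proposal p) t := by
  obtain ⟨k, hk⟩ : ∃ k, S.ChainContains (some (E.proposedId S v k)) q := by
    rcases hE.batch_spec v hL q hq with ⟨k, hk⟩ | ⟨A, I, hA, hAI, hI⟩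
    · exact ⟨k, _, _, rfl, .refl _, Run.contains_proposedId hk⟩
    · have hfol : S.Follows (E.proposedId S v 0) (E.chain S v 0) := Run.proposedId_follows
      rw [show E.chain S v 0 = some A from hA] at hfol
      exact ⟨0, _, I, rfl, .step hfol hAI, hI⟩
  obtain ⟨t, -, ht⟩ := hE.exists_proposesAt hL hτ k fun r hr => hE.not_hasEvidence hL hr _
  exact ⟨_, _, hE.legal_proposalFor hL ht _, rfl, hk, hE.knows_proposalFor hL hL ht⟩

theorem IsExecution.exists_committedRequest_of_leader_mem (hE : IsExecution S E)
    (hL : leader f v ∈ E.honest) (hv : E.IsFinal S v) {q : Req} (hq : q ∈ E.requests)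
    (hr : r ∈ E.honest) : ∃ t, E.CommittedRequest S r q t := by
  obtain ⟨τ, hτ⟩ := hv.enters _ hL
  obtain ⟨p, t, hp, hpv, hpq, hpk⟩ := hE.exists_proposal_chainContains hL hτ hq
  exact hE.exists_committedRequest hv hL hp hpv hpk hpq hr

end FinalView

end Hamster

theorem mainTheorem3 {f : ℕ} {Req D F W : Type*} [Field F] [AddCommGroup W] [Module F W]
    (S : Hamster.System f Req D F W) (E : Hamster.Run f Req D W)
    (hE : Hamster.IsExecution S E) :
    -- honest nodes keep committing identifier blocks, at ever larger heights and at every height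
    (∀ r ∈ E.honest, ∀ (T : ℝ) (h : ℕ), ∃ I t, T ≤ t ∧ h ≤ I.height ∧
      E.DirectlyCommitsAt S r I t) ∧
    (∀ r ∈ E.honest, ∀ h : ℕ, 1 ≤ h → ∃ I t, I.height = h ∧ E.Committed S r I t) ∧
    -- every request is eventually committed, unless it is censored by a permanent malicious leader
    (∀ q ∈ E.requests, ¬ E.Censored S q → ∀ r ∈ E.honest, ∃ t, E.CommittedRequest S r q t) ∧
    -- what happens in a view of an honest leader
    (∀ v, Hamster.leader f v ∈ E.honest →
      -- there is never evidence against the leader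
      (∀ r ∈ E.honest, ∀ t, ¬ E.HasEvidence S r v t) ∧
      -- every honest node votes `p` times within `(3 p + 4) Δ`, and so does not blame the leader
      (∀ r ∈ E.honest, ∀ τ, E.EntersAt S r v τ →
        (∀ p : ℕ, 1 ≤ p → (p : ℕ∞) ≤ (E.votedBy S r v (τ + (3 * p + 4) * S.Δ)).encard) ∧
        ∀ t, ¬ E.BlamesAt S r v t) ∧
      -- once the view is reached, every request is eventually committed
      ((∃ r ∈ E.honest, ∃ τ, E.EntersAt S r v τ) →
        ∀ q ∈ E.requests, ∀ r ∈ E.honest, ∃ t, E.CommittedRequest S r q t)) := by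
  obtain ⟨v, hv⟩ := hE.exists_isFinal
  refine ⟨fun r hr T h => ?_, fun r hr h h1 => ?_, fun q hq hcen r hr => ?_, fun w hL => ?_⟩
  · obtain ⟨I, t, -, hT, hI, hc, -⟩ := hE.exists_directlyCommitsAt hv hr T h
    exact ⟨I, t, hT, hI, hc⟩
  · obtain ⟨I, t, p, -, hI, hc, hp, -, hpI, hpk⟩ := hE.exists_directlyCommitsAt hv hr 0 h
    obtain ⟨J, hIJ, hJ⟩ := hE.exists_ancestor hr hpI hp.2.1
      (Hamster.Run.knows_cert_of_proposal hpk) h1 hI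
    exact ⟨J, t, hJ, I, t, le_rfl, hc, hIJ⟩
  · by_cases hL : Hamster.leader f v ∈ E.honest
    · exact hE.exists_committedRequest_of_leader_mem hL hv hq hr
    · by_contra hno
      refine hcen ⟨v, hL, fun j hj => hv.exists_inView hj, fun j hj p t hk hpv hp hpq => hno ?_⟩
      exact hE.exists_committedRequest hv hj hp hpv hk hpq hr
  · have hN : ∀ r ∈ E.honest, ∀ t, ¬ E.HasEvidence S r w t := fun r hr => hE.not_hasEvidence hL hr
    have hvotes : ∀ r ∈ E.honest, ∀ τ, E.EntersAt S r w τ → ∀ p : ℕ,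
        (p : ℕ∞) ≤ (E.votedBy S r w (τ + (3 * p + 4) * S.Δ)).encard :=
      fun r hr τ hτ p => hE.le_encard_votedBy hL hr hτ p fun j hj => hN j hj _
    refine ⟨hN, fun r hr τ hτ => ⟨fun p _ => hvotes r hr τ hτ p, ?_⟩, ?_⟩
    · rintro t ⟨-, σ, hσ, p, -, rfl, hlt⟩
      exact (hvotes r hr σ hσ p).not_gt hlt
    · rintro ⟨j, hj, τ, hτ⟩ q hq r hr
      exact hE.exists_committedRequest_of_leader_mem hL (hE.isFinal_of_leader_mem hL hj hτ) hq hr
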